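/- Let $n\in\mathbb N$ and let $\Omega\subsetneq\mathbb R^n$ be a proper subdomain (a nonempty connected open set, $\Omega\ne\mathbb R^n$), where $\mathbb R^n$ carries the Euclidean distance $d$. Write $d_\Omega(z)=d(z,\partial\Omega)$, let $\ell(\gamma)$ be the length of a curve $\gamma$, and let $$\sigma_\Omega(x,y)=\inf\ell(\gamma),\qquad k_\Omega(x,y)=\inf\ell_k(\gamma),\qquad \ell_k(\gamma)=\int_\gamma\frac{|dz|}{d_\Omega(z)},$$ where both infima run over all rectifiable curves $\gamma$ in $\Omega$ joining $x$ and $y$. Write $B_\sigma(z,r)=\{w\in\Omega:\sigma_\Omega(z,w)<r\}$. A *quasihyperbolic geodesic* is a rectifiable curve $\gamma$ in $\Omega$ with end points $x,y$ such that $\ell_k(\gamma)=k_\Omega(x,y)$. Let $c_0>0$ and $C>0$, and suppose that 1. $\Omega$ is $c_0$-LLC-2: for all $x\in\Omega$ and $r>0$, any two points of $\Omega\setminus\overline{B(x,r)}$ can be joined by a curve in $\Omega\setminus\overline{B(x,r/c_0)}$; 2. $\Omega$ has the $C$-ball separation property: for every quasihyperbolic geodesic $\gamma$ in $\Omega$,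 every point $z\in\gamma$ and every curve $\alpha$ in $\Omega$ with the same end points as $\gamma$, one has $B_\sigma(z,C\,d_\Omega(z))\cap\alpha\neq\emptyset$. Put $$C_2=(210\,c_0C)^{2n^2+5n},\qquad C_1=\exp\left(C_2^{\,3+4C_2^2}\right).$$ Then $\Omega$ is $C_1$-inner uniform, that is, $C_1\ge 1$ and any two points $z_1,z_2\in\Omega$ can be joined by a rectifiable curve $\gamma$ in $\Omega$ such that $$\min_{j=1,2}\ell(\gamma[z_j,z])\le C_1\,d_\Omega(z)\ \text{ for all } z\in\gamma,\qquad \ell(\gamma)\le C_1\,\sigma_\Omega(z_1,z_2),$$ where $\gamma[z_j,z]$ is the part of $\gamma$ between $z_j$ and $z$. Moreover $\Omega$ satisfies the $C_1$-Gehring–Hayman inequality: for all $x,y\in\Omega$ and every quasihyperbolic geodesic $\gamma$ in $\Omega$ with end points $x$ and $y$, one has $\ell(\gamma)\le C_1\,\sigma_\Omega(x,y)$. -/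

import Mathlib

open scoped ENNReal unitInterval

noncomputable section

namespace QHGeom

variable {X : Type*} [MetricSpace X]

/-- A domain: a nonempty connected open set. -/
def IsDomainSet (Ω : Set X) : Prop := IsOpen Ω ∧ IsConnected Ω

/-- The distance `d_Ω(z) = d(z, ∂Ω)` to the boundary. -/
def bdist (Ω : Set X) (z : X) : ℝ := Metric.infDist z (frontier Ω)

/-- The curve `γ` lies in `Ω`. -/
def InSet (Ω : Set X) {x y : X} (γ : Path x y) : Prop := ∀ t, γ t ∈ Ω

/-- The length of the part of the curve `γ` with parameters in `s`. -/
def lengthOn {x y : X} (γ : Path x y) (s : Set I) : ℝ≥0∞ := eVariationOn (⇑γ) s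

/-- The length of a curve. -/
def len {x y : X} (γ : Path x y) : ℝ≥0∞ := lengthOn γ Set.univ

/-- A curve is rectifiable if its length is finite. -/
def Rectifiable {x y : X} (γ : Path x y) : Prop := len γ ≠ ∞

/-- The inner distance `σ_Ω(x, y)`: the infimum of the lengths of the rectifiable curves joining
`x` to `y` in `Ω` (it is `∞` if there is none). -/
def innerDist (Ω : Set X) (x y : X) : ℝ≥0∞ :=
  ⨅ (γ : Path x y) (_ : InSet Ω γ) (_ : Rectifiable γ), len γ

/-- The open ball of radius `r` about `z` in the inner distance of `Ω`. -/
def innerBall (Ω : Set X) (z : X) (r : ℝ) : Set X :=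
  {w | w ∈ Ω ∧ innerDist Ω z w < ENNReal.ofReal r}

/-- The quasihyperbolic length `∫_γ |dz| / d_Ω(z)` of a rectifiable curve `γ` in `Ω`, computed in
the arc length parametrization of `γ` on `[0, ℓ(γ)]`. -/
def qhLength (Ω : Set X) {x y : X} (γ : Path x y) : ℝ≥0∞ :=
  ∫⁻ s in Set.Icc (0 : ℝ) (len γ).toReal,
    ENNReal.ofReal (1 / bdist Ω (naturalParameterization (⇑γ) Set.univ (0 : I) s))

/-- The quasihyperbolic distance `k_Ω(x, y)`: the infimum of the quasihyperbolic lengths of the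
rectifiable curves joining `x` to `y` in `Ω`. -/
def qhDist (Ω : Set X) (x y : X) : ℝ≥0∞ :=
  ⨅ (γ : Path x y) (_ : InSet Ω γ) (_ : Rectifiable γ), qhLength Ω γ

/-- `γ` is a quasihyperbolic geodesic in `Ω`: a rectifiable curve in `Ω` whose quasihyperbolic
length is the quasihyperbolic distance of its end points. -/
def IsQHGeodesic (Ω : Set X) {x y : X} (γ : Path x y) : Prop :=
  InSet Ω γ ∧ Rectifiable γ ∧ qhLength Ω γ = qhDist Ω x y

/-- The `C`-Gehring–Hayman inequality. -/
def GehringHayman (Ω : Set X) (C : ℝ) : Prop :=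
  ∀ ⦃x y : X⦄ (γ : Path x y), IsQHGeodesic Ω γ →
    len γ ≤ ENNReal.ofReal C * innerDist Ω x y

/-- The `C`-ball separation condition: for every quasihyperbolic geodesic `γ` in `Ω`, every point
`z` on it and every curve `α` in `Ω` with the same end points, the inner ball
`B_σ(z, C d_Ω(z))` meets `α`. -/
def BallSeparation (Ω : Set X) (C : ℝ) : Prop :=
  ∀ ⦃x y : X⦄ (γ : Path x y), IsQHGeodesic Ω γ →
    ∀ z ∈ Set.range γ, ∀ α : Path x y, InSet Ω α →
      (innerBall Ω z (C * bdist Ω z) ∩ Set.range α).Nonempty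

/-- `c`-LLC-2: any two points of `Ω` outside the closure of `B(x, r)` can be joined in `Ω`
outside the closure of `B(x, r / c)`. -/
def LLC2 (Ω : Set X) (c : ℝ) : Prop :=
  ∀ x ∈ Ω, ∀ r : ℝ, 0 < r →
    ∀ a ∈ Ω \ closure (Metric.ball x r), ∀ b ∈ Ω \ closure (Metric.ball x r),
      JoinedIn (Ω \ closure (Metric.ball x (r / c))) a b

/-- `γ` is a `c`-inner uniform curve in `Ω`: a rectifiable curve in `Ω` such that at each of its
points the shorter of the two subcurves has length at most `c` times the distance to the boundary,
and whose length is at most `c` times the inner distance of its end points. -/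
def IsInnerUniformCurve (Ω : Set X) (c : ℝ) {x y : X} (γ : Path x y) : Prop :=
  InSet Ω γ ∧ Rectifiable γ ∧
    (∀ t : I, min (lengthOn γ (Set.Iic t)) (lengthOn γ (Set.Ici t)) ≤
      ENNReal.ofReal (c * bdist Ω (γ t))) ∧
    len γ ≤ ENNReal.ofReal c * innerDist Ω x y

/-- `Ω` is `c`-inner uniform (`c ≥ 1`): any two of its points can be joined by a `c`-inner uniform
curve. -/
def InnerUniform (Ω : Set X) (c : ℝ) : Prop :=
  1 ≤ c ∧ ∀ x ∈ Ω, ∀ y ∈ Ω, ∃ γ : Path x y, IsInnerUniformCurve Ω c γ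

/-- `C₂ = (210 c₀ C)^(2n² + 5n)`. -/
def constC2 (n : ℕ) (c₀ C : ℝ) : ℝ := (210 * c₀ * C) ^ (2 * n ^ 2 + 5 * n)

/-- `C₁ = exp (C₂ ^ (3 + 4 C₂²))`. -/
def constC1 (n : ℕ) (c₀ C : ℝ) : ℝ :=
  Real.exp (constC2 n c₀ C ^ (3 + 4 * constC2 n c₀ C ^ 2))

end QHGeom

end

open scoped ENNReal unitInterval

noncomputable section

namespace QHGeom

set_option linter.unusedSectionVars false

open Set Metric MeasureTheory Filter Topology BoundedContinuousFunction

variable {E : Type*} [NormedAddCommGroup E] [NormedSpace ℝ E] {Ω : Set E}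

/-! Write d for the distance to the boundary and A = c₀C. If both halves of a quasihyperbolic
geodesic left the ball of radius A·d(z) about one of its points z, LLC-2 would join two points of
the geodesic on either side of z outside B(z, C·d(z)). Since the Euclidean distance is at most σ,
this contradicts ball separation for the subgeodesic through z. So one half stays within A·d(z) of z
(`IsMinimal.diamCigar`).

Diameter is upgraded to length by counting volumes. In a bounded region where d is comparable to r,
points far apart along a geodesic are quasihyperbolically far apart, hence separated by a multiple
of r, so there are boundedly many of them. Summing over dyadic heights gives the length cigar
condition with a constant M (`lengthCigar_of_diamCigar`).

The core is `LengthCigar.length_le`: a geodesic of length l is compared with a curve α of length L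
having the same end points. If l is much larger than L, the points at arc length L from the two ends
have height at least L/M, and they are joined by a connected set of diameter O(L) made of α and the
two end arcs. This set may come close to the boundary, so it is replaced by a discrete chain, which
is pushed inward until it has height comparable to L. Each push doubles the height s and moves the
chain by O(s), so the total displacement is a geometric sum of order L (`LengthCigar.chain_lift`). A
chain of height comparable to L in a ball of radius O(L) meets boundedly many balls of radius
comparable to L, so its ends have bounded quasihyperbolic distance (`Chain.kd_le`), and the geodesic
between them has length O(L).

Hence geodesics satisfy the Gehring–Hayman inequality, and as they exist
(`ProperDomain.exists_isMinimal`) they serve as the inner uniform curves. The remaining work is to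
bound the constants. -/

/-- A domain with nonempty boundary. -/
structure ProperDomain (Ω : Set E) : Prop where
  isOpen : IsOpen Ω
  isConnected : IsConnected Ω
  frontier_nonempty : (frontier Ω).Nonempty

theorem IsDomainSet.properDomain (h : IsDomainSet Ω) (h' : Ω ≠ univ) : ProperDomain Ω :=
  ⟨h.1, h.2, nonempty_frontier_iff.2 ⟨h.2.nonempty, h'⟩⟩

theorem ProperDomain.bdist_pos (hΩ : ProperDomain Ω) {x : E} (hx : x ∈ Ω) : 0 < bdist Ω x := by
  refine (isClosed_frontier.notMem_iff_infDist_pos hΩ.frontier_nonempty).1 fun h => ?_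
  have := hΩ.isOpen.inter_frontier_eq
  exact (this ▸ (⟨hx, h⟩ : x ∈ Ω ∩ frontier Ω) : x ∈ (∅ : Set E))

theorem bdist_le_add (Ω : Set E) (x y : E) : bdist Ω x ≤ bdist Ω y + dist x y :=
  infDist_le_infDist_add_dist

theorem continuous_bdist (Ω : Set E) : Continuous (bdist Ω) := continuous_infDist_pt _

/-- The ball of radius d(x) about x is connected, meets Ω and misses the frontier, so it cannot
leave Ω. -/
theorem ProperDomain.mem_of_dist_lt (hΩ : ProperDomain Ω) {x y : E} (hx : x ∈ Ω)
    (hy : dist y x < bdist Ω x) : y ∈ Ω := by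
  have key : ball x (bdist Ω x) ⊆ Ω := by
    refine (convex_ball x _).isPreconnected.subset_of_closure_inter_subset hΩ.isOpen
      ⟨x, mem_ball_self (hΩ.bdist_pos hx), hx⟩ ?_
    rintro z ⟨hz, hzb⟩
    by_contra hzΩ
    have hzf : z ∈ frontier Ω := by
      rw [hΩ.isOpen.frontier_eq]; exact ⟨hz, hzΩ⟩
    have := infDist_le_dist_of_mem (x := x) hzf
    rw [mem_ball, dist_comm] at hzb
    exact absurd hzb (not_lt.2 this)
  exact key hy

/-! ### Lipschitz curves and their quasihyperbolic length -/

/-- A curve in `Ω` parametrized by a `1`-Lipschitz map. -/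
structure IsCurve (Ω : Set E) (g : ℝ → E) : Prop where
  lipschitz : LipschitzWith 1 g
  mem : ∀ t, g t ∈ Ω

theorem IsCurve.dist_le {g : ℝ → E} (hg : IsCurve Ω g) (s t : ℝ) : dist (g s) (g t) ≤ |s - t| := by
  simpa [Real.dist_eq] using hg.lipschitz.dist_le_mul s t

theorem IsCurve.of_dist_le {g : ℝ → E} (h : ∀ s t, dist (g s) (g t) ≤ |s - t|)
    (hm : ∀ t, g t ∈ Ω) : IsCurve Ω g :=
  ⟨LipschitzWith.of_dist_le_mul fun s t => by simpa [Real.dist_eq] using h s t, hm⟩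

theorem IsCurve.of_dist_le_of_le {g : ℝ → E} (h : ∀ s t, s ≤ t → dist (g s) (g t) ≤ t - s)
    (hm : ∀ t, g t ∈ Ω) : IsCurve Ω g := by
  refine .of_dist_le (fun s t => ?_) hm
  rcases le_total s t with hst | hst
  · rw [abs_sub_comm, abs_of_nonneg (sub_nonneg.2 hst)]; exact h s t hst
  · rw [dist_comm, abs_of_nonneg (sub_nonneg.2 hst)]; exact h t s hst

theorem IsCurve.continuous {g : ℝ → E} (hg : IsCurve Ω g) : Continuous g := hg.lipschitz.continuous

theorem IsCurve.comp {g : ℝ → E} (hg : IsCurve Ω g) {φ : ℝ → ℝ} (hφ : ∀ s t, |φ s - φ t| ≤ |s - t|) :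
    IsCurve Ω (fun t => g (φ t)) :=
  .of_dist_le (fun s t => (hg.dist_le _ _).trans (hφ s t)) fun _ => hg.mem _

/-- The map `t ↦ t` on `[a, b]`, extended constantly. -/
def clamp (a b t : ℝ) : ℝ := max a (min b t)

theorem clamp_of_mem {a b t : ℝ} (h : t ∈ Icc a b) : clamp a b t = t := by
  simp [clamp, h.1, h.2]

theorem clamp_mem {a b : ℝ} (hab : a ≤ b) (t : ℝ) : clamp a b t ∈ Icc a b :=
  ⟨le_max_left _ _, max_le hab (min_le_left _ _)⟩

theorem abs_clamp_sub_le (a b s t : ℝ) : |clamp a b s - clamp a b t| ≤ |s - t| := by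
  unfold clamp
  calc |max a (min b s) - max a (min b t)| ≤ |min b s - min b t| := by
        rw [max_comm a, max_comm a]
        exact abs_max_sub_max_le_abs _ _ _
    _ ≤ |s - t| := by
        rw [min_comm b, min_comm b]
        exact abs_inf_sub_inf_le_abs _ _ _

/-- The quasihyperbolic length of the part of `g` with parameters between `a` and `b`. -/
def qcost (Ω : Set E) (g : ℝ → E) (a b : ℝ) : ℝ := ∫ t in a..b, (bdist Ω (g t))⁻¹

theorem IsCurve.continuous_inv_bdist (hΩ : ProperDomain Ω) {g : ℝ → E} (hg : IsCurve Ω g) :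
    Continuous fun t => (bdist Ω (g t))⁻¹ :=
  ((continuous_bdist Ω).comp hg.continuous).inv₀ fun t => (hΩ.bdist_pos (hg.mem t)).ne'

theorem IsCurve.intervalIntegrable (hΩ : ProperDomain Ω) {g : ℝ → E} (hg : IsCurve Ω g) (a b : ℝ) :
    IntervalIntegrable (fun t => (bdist Ω (g t))⁻¹) volume a b :=
  (hg.continuous_inv_bdist hΩ).intervalIntegrable a b

theorem IsCurve.qcost_add (hΩ : ProperDomain Ω) {g : ℝ → E} (hg : IsCurve Ω g) (a b c : ℝ) :
    qcost Ω g a b + qcost Ω g b c = qcost Ω g a c :=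
  intervalIntegral.integral_add_adjacent_intervals (hg.intervalIntegrable hΩ a b)
    (hg.intervalIntegrable hΩ b c)

theorem IsCurve.qcost_nonneg (hΩ : ProperDomain Ω) {g : ℝ → E} (hg : IsCurve Ω g) {a b : ℝ}
    (hab : a ≤ b) : 0 ≤ qcost Ω g a b :=
  intervalIntegral.integral_nonneg hab fun t _ => (inv_pos.2 (hΩ.bdist_pos (hg.mem t))).le

theorem qcost_congr {g h : ℝ → E} {a b : ℝ} (hab : a ≤ b) (hgh : ∀ t ∈ Icc a b, g t = h t) :
    qcost Ω g a b = qcost Ω h a b := by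
  refine intervalIntegral.integral_congr fun t ht => ?_
  rw [uIcc_of_le hab] at ht
  simp only [hgh t ht]

theorem qcost_comp_add (g : ℝ → E) (a b c : ℝ) :
    qcost Ω (fun t => g (t + c)) a b = qcost Ω g (a + c) (b + c) :=
  intervalIntegral.integral_comp_add_right (fun t => (bdist Ω (g t))⁻¹) c

theorem qcost_comp_sub (g : ℝ → E) (a b c : ℝ) :
    qcost Ω (fun t => g (c - t)) a b = qcost Ω g (c - b) (c - a) :=
  intervalIntegral.integral_comp_sub_left (fun t => (bdist Ω (g t))⁻¹) c

theorem IsCurve.qcost_le (hΩ : ProperDomain Ω) {g : ℝ → E} (hg : IsCurve Ω g) {a b r : ℝ}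
    (hab : a ≤ b) (hr : 0 < r) (h : ∀ t ∈ Icc a b, r ≤ bdist Ω (g t)) :
    qcost Ω g a b ≤ (b - a) / r := by
  have := intervalIntegral.integral_mono_on hab (hg.intervalIntegrable hΩ a b)
    (intervalIntegrable_const (c := r⁻¹)) fun t ht => inv_anti₀ hr (h t ht)
  rwa [intervalIntegral.integral_const, smul_eq_mul, ← div_eq_mul_inv] at this

theorem IsCurve.le_qcost (hΩ : ProperDomain Ω) {g : ℝ → E} (hg : IsCurve Ω g) {a b r : ℝ}
    (hab : a ≤ b) (h : ∀ t ∈ Icc a b, bdist Ω (g t) ≤ r) :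
    (b - a) / r ≤ qcost Ω g a b := by
  have := intervalIntegral.integral_mono_on hab (intervalIntegrable_const (c := r⁻¹))
    (hg.intervalIntegrable hΩ a b) fun t ht => inv_anti₀ (hΩ.bdist_pos (hg.mem t)) (h t ht)
  rwa [intervalIntegral.integral_const, smul_eq_mul, ← div_eq_mul_inv] at this

/-- The length of a curve is controlled by its quasihyperbolic length. -/
theorem IsCurve.length_le (hΩ : ProperDomain Ω) {g : ℝ → E} (hg : IsCurve Ω g) {a b : ℝ}
    (hab : a ≤ b) : b - a ≤ bdist Ω (g a) * (Real.exp (qcost Ω g a b) - 1) := by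
  set d := bdist Ω (g a) with hd
  have hd0 : 0 < d := hΩ.bdist_pos (hg.mem a)
  have hpos : ∀ t ∈ Icc a b, 0 < d - a + t := fun t ht => by linarith [ht.1]
  -- Along the curve the height grows at most at unit speed, from d at time a. Integrating its
  -- reciprocal gives a logarithm.
  have h1 : ∫ t in a..b, (d - a + t)⁻¹ ≤ qcost Ω g a b := by
    refine intervalIntegral.integral_mono_on hab ?_ (hg.intervalIntegrable hΩ a b) fun t ht => ?_
    · refine ContinuousOn.intervalIntegrable ?_
      rw [uIcc_of_le hab]
      exact (by fun_prop : Continuous fun t => d - a + t).continuousOn.inv₀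
        fun t ht => (hpos t ht).ne'
    · refine inv_anti₀ (hΩ.bdist_pos (hg.mem t)) ?_
      have h1 := bdist_le_add Ω (g t) (g a)
      have h2 := hg.dist_le t a
      rw [abs_of_nonneg (by linarith [ht.1])] at h2
      linarith
  have h2 : ∫ t in a..b, (d - a + t)⁻¹ = Real.log ((d - a + b) / d) := by
    rw [intervalIntegral.integral_comp_add_left (fun t => t⁻¹) (d - a),
      integral_inv_of_pos (by linarith) (by linarith)]
    congr 2; ring
  rw [h2, Real.log_le_iff_le_exp (by apply div_pos <;> linarith), div_le_iff₀ hd0] at h1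
  linarith

theorem IsCurve.bdist_le_mul_exp (hΩ : ProperDomain Ω) {g : ℝ → E} (hg : IsCurve Ω g) {a b : ℝ}
    (hab : a ≤ b) : bdist Ω (g b) ≤ bdist Ω (g a) * Real.exp (qcost Ω g a b) := by
  have h1 := bdist_le_add Ω (g b) (g a)
  have h2 := hg.dist_le b a
  rw [abs_of_nonneg (by linarith)] at h2
  linarith [hg.length_le hΩ hab]

theorem IsCurve.reverse {g : ℝ → E} (hg : IsCurve Ω g) (c : ℝ) : IsCurve Ω fun t => g (c - t) :=
  hg.comp fun s t => by rw [show c - s - (c - t) = -(s - t) by ring, abs_neg]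

theorem IsCurve.translate {g : ℝ → E} (hg : IsCurve Ω g) (c : ℝ) : IsCurve Ω fun t => g (t + c) :=
  hg.comp fun s t => by simp

/-- `g` up to time `m`, followed by `h`. -/
def concat (g h : ℝ → E) (m t : ℝ) : E := if t ≤ m then g t else h (t - m)

theorem IsCurve.concat {g h : ℝ → E} (hg : IsCurve Ω g) (hh : IsCurve Ω h) {m : ℝ}
    (hm : g m = h 0) : IsCurve Ω (concat g h m) := by
  refine .of_dist_le_of_le (fun s t hst => ?_) fun t => ?_
  · have key : ∀ u v, u ≤ v → dist (g u) (g v) ≤ v - u := fun u v huv => by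
      simpa [abs_sub_comm u, abs_of_nonneg (sub_nonneg.2 huv)] using hg.dist_le u v
    have key' : ∀ u v, u ≤ v → dist (h u) (h v) ≤ v - u := fun u v huv => by
      simpa [abs_sub_comm u, abs_of_nonneg (sub_nonneg.2 huv)] using hh.dist_le u v
    unfold QHGeom.concat
    split_ifs with h1 h2 h2
    · exact key s t hst
    · have h3 := key s m h1
      have h4 := key' 0 (t - m) (by linarith)
      rw [hm] at h3
      linarith [dist_triangle (g s) (h 0) (h (t - m))]
    · linarith
    · have := key' (s - m) (t - m) (by linarith)
      linarith
  · unfold QHGeom.concat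
    split_ifs
    exacts [hg.mem _, hh.mem _]

theorem qcost_concat (hΩ : ProperDomain Ω) {g h : ℝ → E} (hg : IsCurve Ω g) (hh : IsCurve Ω h)
    {m l : ℝ} (hm : g m = h 0) (hm0 : 0 ≤ m) (hl : 0 ≤ l) :
    qcost Ω (concat g h m) 0 (m + l) = qcost Ω g 0 m + qcost Ω h 0 l := by
  rw [← (hg.concat hh hm).qcost_add hΩ 0 m (m + l)]
  congr 1
  · exact qcost_congr hm0 fun t ht => by simp [concat, ht.2]
  · rw [show qcost Ω h 0 l = qcost Ω (fun t => h (t + -m)) m (m + l) by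
      rw [qcost_comp_add]; ring_nf]
    refine qcost_congr (by linarith) fun t ht => ?_
    rcases eq_or_lt_of_le ht.1 with rfl | h1
    · simp [concat, hm]
    · simp [concat, not_le.2 h1, sub_eq_add_neg]

/-- The segment from `x` to `y`, parametrized by arc length. -/
theorem ProperDomain.exists_segment (hΩ : ProperDomain Ω) {x y : E} (hx : x ∈ Ω)
    (hxy : dist x y ≤ bdist Ω x / 2) :
    ∃ g, IsCurve Ω g ∧ g 0 = x ∧ g (dist x y) = y ∧ ∀ t, dist (g t) x ≤ bdist Ω x / 2 := by
  have hd := hΩ.bdist_pos hx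
  have main : ∃ g : ℝ → E, (∀ s t, dist (g s) (g t) ≤ |s - t|) ∧ g 0 = x ∧ g (dist x y) = y ∧
      ∀ t, dist (g t) x ≤ bdist Ω x / 2 := by
    by_cases h : x = y
    · subst h
      exact ⟨fun _ => x, fun s t => by simp, rfl, rfl,
        fun t => by simpa using (half_pos hd).le⟩
    have hn : 0 < dist x y := dist_pos.2 h
    refine ⟨fun t => AffineMap.lineMap x y (clamp 0 (dist x y) t / dist x y), fun s t => ?_, ?_,
      ?_, fun t => ?_⟩
    · rw [dist_lineMap_lineMap, Real.dist_eq, ← sub_div, abs_div, abs_of_pos hn,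
        div_mul_cancel₀ _ hn.ne']
      exact abs_clamp_sub_le _ _ _ _
    · simp [clamp, hn.le]
    · simp [clamp, hn.ne']
    · rw [dist_lineMap_left, Real.norm_of_nonneg (by have := (clamp_mem hn.le t).1; positivity),
        div_mul_cancel₀ _ hn.ne']
      exact (clamp_mem hn.le t).2.trans hxy
  obtain ⟨g, h1, h2, h3, h4⟩ := main
  exact ⟨g, .of_dist_le h1 fun t => hΩ.mem_of_dist_lt hx ((h4 t).trans_lt (by linarith)),
    h2, h3, h4⟩

/-! ### The quasihyperbolic distance as a real infimum -/

/-- The quasihyperbolic lengths of the curves from `x` to `y`. -/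
def costSet (Ω : Set E) (x y : E) : Set ℝ :=
  {c | ∃ g m, IsCurve Ω g ∧ 0 ≤ m ∧ g 0 = x ∧ g m = y ∧ qcost Ω g 0 m = c}

/-- The quasihyperbolic distance, as a real number. -/
def kd (Ω : Set E) (x y : E) : ℝ := sInf (costSet Ω x y)

theorem ProperDomain.nonneg_of_mem_costSet (hΩ : ProperDomain Ω) {x y : E} {c : ℝ}
    (hc : c ∈ costSet Ω x y) : 0 ≤ c := by
  obtain ⟨g, m, hg, hm, -, -, rfl⟩ := hc
  exact hg.qcost_nonneg hΩ hm

theorem ProperDomain.bddBelow_costSet (hΩ : ProperDomain Ω) (x y : E) :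
    BddBelow (costSet Ω x y) := ⟨0, fun _ hc => hΩ.nonneg_of_mem_costSet hc⟩

theorem ProperDomain.kd_nonneg (hΩ : ProperDomain Ω) (x y : E) : 0 ≤ kd Ω x y :=
  Real.sInf_nonneg fun _ hc => hΩ.nonneg_of_mem_costSet hc

theorem IsCurve.kd_le (hΩ : ProperDomain Ω) {g : ℝ → E} (hg : IsCurve Ω g) {a b : ℝ}
    (hab : a ≤ b) : kd Ω (g a) (g b) ≤ qcost Ω g a b := by
  refine csInf_le (hΩ.bddBelow_costSet _ _)
    ⟨fun t => g (t + a), b - a, hg.translate a, by linarith, by simp, by simp, ?_⟩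
  rw [qcost_comp_add]; simp

theorem ProperDomain.mem_costSet_trans (hΩ : ProperDomain Ω) {x y z : E} {c c' : ℝ}
    (h : c ∈ costSet Ω x y) (h' : c' ∈ costSet Ω y z) : c + c' ∈ costSet Ω x z := by
  obtain ⟨g, m, hg, hm, h0, h1, rfl⟩ := h
  obtain ⟨g', m', hg', hm', h0', h1', rfl⟩ := h'
  have hgg : g m = g' 0 := h1.trans h0'.symm
  refine ⟨concat g g' m, m + m', hg.concat hg' hgg, by linarith, by simp [concat, hm, h0], ?_,
    qcost_concat hΩ hg hg' hgg hm hm'⟩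
  by_cases hm0 : m' = 0
  · subst hm0
    simp [concat, hgg, h1']
  · have : ¬ m' ≤ 0 := fun h => hm0 (le_antisymm h hm')
    simp [concat, this, h1']

theorem mem_costSet_symm {x y : E} {c : ℝ}
    (h : c ∈ costSet Ω x y) : c ∈ costSet Ω y x := by
  obtain ⟨g, m, hg, hm, h0, h1, rfl⟩ := h
  exact ⟨fun t => g (m - t), m, hg.reverse m, hm, by simp [h1], by simp [h0],
    by rw [qcost_comp_sub]; simp⟩

theorem kd_comm (Ω : Set E) (x y : E) : kd Ω x y = kd Ω y x := by
  unfold kd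
  congr 1
  ext c
  exact ⟨mem_costSet_symm, mem_costSet_symm⟩

/-- Nearby points are joined by segments, and connectedness does the rest. This keeps `kd` from
being the default value 0 of `sInf ∅`. -/
theorem ProperDomain.costSet_nonempty (hΩ : ProperDomain Ω) {x y : E} (hx : x ∈ Ω) (hy : y ∈ Ω) :
    (costSet Ω x y).Nonempty := by
  refine hΩ.isConnected.isPreconnected.induction₂' (fun x y => (costSet Ω x y).Nonempty)
    (fun x hx => ?_) (fun x y z _ _ _ ⟨c, hc⟩ ⟨c', hc'⟩ => ⟨c + c', hΩ.mem_costSet_trans hc hc'⟩)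
    hx hy
  filter_upwards [nhdsWithin_le_nhds (closedBall_mem_nhds x (half_pos (hΩ.bdist_pos hx)))] with y hy
  rw [mem_closedBall, dist_comm] at hy
  obtain ⟨g, hg, h0, h1, -⟩ := hΩ.exists_segment hx hy
  have : qcost Ω g 0 (dist x y) ∈ costSet Ω x y := ⟨g, _, hg, dist_nonneg, h0, h1, rfl⟩
  exact ⟨⟨_, this⟩, ⟨_, mem_costSet_symm this⟩⟩

theorem ProperDomain.kd_triangle (hΩ : ProperDomain Ω) {x y z : E} (hx : x ∈ Ω) (hy : y ∈ Ω)
    (hz : z ∈ Ω) : kd Ω x z ≤ kd Ω x y + kd Ω y z := by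
  rw [← sub_le_iff_le_add']
  refine le_csInf (hΩ.costSet_nonempty hy hz) fun c hc => ?_
  rw [sub_le_comm]
  refine le_csInf (hΩ.costSet_nonempty hx hy) fun c' hc' => ?_
  rw [sub_le_iff_le_add]
  exact csInf_le (hΩ.bddBelow_costSet _ _) (hΩ.mem_costSet_trans hc' hc)

theorem ProperDomain.kd_le_of_dist_le (hΩ : ProperDomain Ω) {x y : E} (hx : x ∈ Ω)
    (hxy : dist x y ≤ bdist Ω x / 2) : kd Ω x y ≤ dist x y / (bdist Ω x / 2) := by
  obtain ⟨g, hg, h0, h1, h2⟩ := hΩ.exists_segment hx hxy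
  have h3 := hg.kd_le hΩ (a := 0) (b := dist x y) dist_nonneg
  rw [h0, h1] at h3
  refine h3.trans ((hg.qcost_le hΩ dist_nonneg (half_pos (hΩ.bdist_pos hx)) fun t _ => ?_).trans
    (by simp))
  have := bdist_le_add Ω x (g t)
  rw [dist_comm] at this
  linarith [h2 t]

theorem ProperDomain.kd_le_one (hΩ : ProperDomain Ω) {x y : E} (hx : x ∈ Ω)
    (hxy : dist x y ≤ bdist Ω x / 2) : kd Ω x y ≤ 1 :=
  (hΩ.kd_le_of_dist_le hx hxy).trans
    ((div_le_one (half_pos (hΩ.bdist_pos hx))).2 hxy)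

theorem ProperDomain.kd_self (hΩ : ProperDomain Ω) {x : E} (hx : x ∈ Ω) : kd Ω x x = 0 :=
  le_antisymm ((hΩ.kd_le_of_dist_le hx
    ((dist_self x).trans_le (half_pos (hΩ.bdist_pos hx)).le)).trans (by simp)) (hΩ.kd_nonneg _ _)

/-! ### Minimal curves and their existence -/

/-- A curve on `[0, l]` of minimal quasihyperbolic length. -/
structure IsMinimal (Ω : Set E) (g : ℝ → E) (l : ℝ) : Prop where
  nonneg : 0 ≤ l
  curve : IsCurve Ω g
  qcost_le : qcost Ω g 0 l ≤ kd Ω (g 0) (g l)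

/-- By the triangle inequality, any excess on a part would be an excess of the whole curve. -/
theorem IsMinimal.qcost_eq (hΩ : ProperDomain Ω) {g : ℝ → E} {l a b : ℝ} (hg : IsMinimal Ω g l)
    (ha : 0 ≤ a) (hab : a ≤ b) (hb : b ≤ l) : qcost Ω g a b = kd Ω (g a) (g b) := by
  refine le_antisymm ?_ (hg.curve.kd_le hΩ hab)
  have h1 := hg.curve.qcost_add hΩ 0 a b
  have h2 := hg.curve.qcost_add hΩ 0 b l
  have h3 := hg.qcost_le
  have h4 := hg.curve.kd_le hΩ ha
  have h5 := hg.curve.kd_le hΩ hb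
  have h6 := hΩ.kd_triangle (hg.curve.mem 0) (hg.curve.mem a) (hg.curve.mem l)
  have h7 := hΩ.kd_triangle (hg.curve.mem a) (hg.curve.mem b) (hg.curve.mem l)
  linarith

theorem IsMinimal.sub (hΩ : ProperDomain Ω) {g : ℝ → E} {l a b : ℝ} (hg : IsMinimal Ω g l)
    (ha : 0 ≤ a) (hab : a ≤ b) (hb : b ≤ l) : IsMinimal Ω (fun t => g (t + a)) (b - a) where
  nonneg := by linarith
  curve := hg.curve.translate a
  qcost_le := by
    rw [qcost_comp_add]
    simpa using (hg.qcost_eq hΩ ha hab hb).le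

theorem IsMinimal.reverse {g : ℝ → E} {l : ℝ} (hg : IsMinimal Ω g l) :
    IsMinimal Ω (fun t => g (l - t)) l where
  nonneg := hg.nonneg
  curve := hg.curve.reverse l
  qcost_le := by
    rw [qcost_comp_sub, kd_comm]
    simpa using hg.qcost_le

theorem IsCurve.le_bdist_mul_exp (hΩ : ProperDomain Ω) {g : ℝ → E} (hg : IsCurve Ω g) {a b : ℝ}
    (hab : a ≤ b) : bdist Ω (g a) ≤ bdist Ω (g b) * Real.exp (qcost Ω g a b) := by
  have := (hg.reverse (a + b)).bdist_le_mul_exp hΩ hab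
  rw [qcost_comp_sub] at this
  simpa using this

/-- Any two points of a proper domain can be joined by a quasihyperbolic geodesic. -/
theorem ProperDomain.exists_isMinimal [ProperSpace E] (hΩ : ProperDomain Ω) {x y : E}
    (hx : x ∈ Ω) (hy : y ∈ Ω) : ∃ g l, IsMinimal Ω g l ∧ g 0 = x ∧ g l = y := by
  set κ := kd Ω x y with hκ
  have hd := hΩ.bdist_pos hx
  -- A curve from x of cost at most κ + 1 has length at most L and height at least c, so it stays in
  -- the compact set F. Arzelà–Ascoli then applies to curves on the fixed interval [0, L], with the
  -- stopping time as an additional compact parameter.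
  set L := bdist Ω x * (Real.exp (κ + 1) - 1) with hL
  set c := bdist Ω x * Real.exp (-(κ + 1)) with hc
  have hκ0 : 0 ≤ κ := hΩ.kd_nonneg x y
  have hL0 : 0 ≤ L := mul_nonneg hd.le (by linarith [Real.add_one_le_exp (κ + 1)])
  have hc0 : 0 < c := by positivity
  set F : Set E := closure Ω ∩ closedBall x L ∩ {z | c ≤ bdist Ω z} with hF
  have hFc : IsCompact F :=
    ((isCompact_closedBall x L).inter_left isClosed_closure).inter_right
      (isClosed_le continuous_const (continuous_bdist Ω))
  have hFΩ : F ⊆ Ω := by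
    rintro z ⟨⟨h1, -⟩, h2⟩
    by_contra h3
    have h4 : z ∈ frontier Ω := by rw [hΩ.isOpen.frontier_eq]; exact ⟨h1, h3⟩
    have : bdist Ω z = 0 := infDist_zero_of_mem h4
    rw [mem_ofPred_eq, this] at h2
    linarith
  set A : Set (Icc 0 L →ᵇ E) := {f | (∀ t, f t ∈ F) ∧ ∀ s t, dist (f s) (f t) ≤ dist s t} with hA
  have hAc : IsCompact A := by
    refine arzela_ascoli₂ F hFc A ?_ (fun f t hf => hf.1 t) ?_
    · rw [hA, ofPred_and]
      refine IsClosed.inter ?_ ?_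
      · simp only [ofPred_forall]
        exact isClosed_iInter fun t => hFc.isClosed.preimage (continuous_eval_const t)
      · simp only [ofPred_forall]
        exact isClosed_iInter fun s => isClosed_iInter fun t =>
          isClosed_le ((continuous_eval_const s).dist (continuous_eval_const t)) continuous_const
    · refine Metric.equicontinuous_of_continuity_modulus (fun r => r) tendsto_id _ ?_
      exact fun s t f => f.2.2 s t
  set P : ℝ → Icc (0 : ℝ) L := projIcc 0 L hL0 with hP
  have hPc : Continuous P := continuous_projIcc
  set K : Set (ℝ × (Icc 0 L →ᵇ E)) :=
    (Icc 0 L ×ˢ A) ∩ {p | p.2 (P 0) = x ∧ p.2 (P p.1) = y} with hK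
  have hev : Continuous fun q : (ℝ × (Icc 0 L →ᵇ E)) × ℝ => q.1.2 (P q.2) :=
    (continuous_snd.comp continuous_fst).eval (hPc.comp continuous_snd)
  have hKc : IsCompact K := by
    refine (isCompact_Icc.prod hAc).inter_right ?_
    rw [ofPred_and]
    have h1 : Continuous fun p : ℝ × (Icc 0 L →ᵇ E) => p.2 (P 0) :=
      continuous_snd.eval continuous_const
    have h2 : Continuous fun p : ℝ × (Icc 0 L →ᵇ E) => p.2 (P p.1) :=
      continuous_snd.eval (hPc.comp continuous_fst)
    exact IsClosed.inter (isClosed_eq h1 continuous_const) (isClosed_eq h2 continuous_const)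
  -- Truncation at c makes the cost continuous on the whole function space. It changes nothing for
  -- curves in F.
  set Φ : ℝ × (Icc 0 L →ᵇ E) → ℝ := fun p => ∫ t in (0 : ℝ)..p.1, (max c (bdist Ω (p.2 (P t))))⁻¹
    with hΦ
  have hΦc : Continuous Φ := by
    have h1 : Continuous fun q : (ℝ × (Icc 0 L →ᵇ E)) × ℝ => (max c (bdist Ω (q.1.2 (P q.2))))⁻¹ :=
      (continuous_const.max ((continuous_bdist Ω).comp hev)).inv₀
        fun q => (hc0.trans_le (le_max_left _ _)).ne'
    exact intervalIntegral.continuous_parametric_intervalIntegral_of_continuous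
      (f := fun (p : ℝ × (Icc 0 L →ᵇ E)) t => (max c (bdist Ω (p.2 (P t))))⁻¹) h1 continuous_fst
  have key : ∀ c' ∈ costSet Ω x y, c' < κ + 1 → ∃ p ∈ K, Φ p = c' := by
    rintro _ ⟨g, m, hg, hm, h0, h1, rfl⟩ hcost
    have hsub : ∀ t ∈ Icc 0 m, qcost Ω g 0 t ≤ κ + 1 := fun t ht => by
      have h3 := hg.qcost_add hΩ 0 t m
      have h4 := hg.qcost_nonneg hΩ ht.2
      linarith
    have hlen : ∀ t ∈ Icc 0 m, t ≤ L := fun t ht => by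
      have h2 := hg.length_le hΩ ht.1
      have h3 := Real.exp_le_exp.2 (hsub t ht)
      rw [h0] at h2
      have := mul_le_mul_of_nonneg_left (sub_le_sub_right h3 1) hd.le
      linarith
    have hbd : ∀ t ∈ Icc 0 m, c ≤ bdist Ω (g t) := fun t ht => by
      have h2 := hg.le_bdist_mul_exp hΩ ht.1
      have h3 := Real.exp_le_exp.2 (hsub t ht)
      rw [h0] at h2
      rw [hc, Real.exp_neg, ← div_eq_mul_inv, div_le_iff₀ (Real.exp_pos _)]
      exact h2.trans (mul_le_mul_of_nonneg_left h3 (hΩ.bdist_pos (hg.mem t)).le)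
    have hmem : ∀ t ∈ Icc 0 m, g t ∈ F := fun t ht => by
      refine ⟨⟨subset_closure (hg.mem t), ?_⟩, hbd t ht⟩
      have h2 := hg.dist_le t 0
      rw [h0, sub_zero, abs_of_nonneg ht.1] at h2
      exact mem_closedBall.2 (h2.trans (hlen t ht))
    have hcl : IsCurve Ω fun t => g (clamp 0 m t) := hg.comp fun s t => abs_clamp_sub_le 0 m s t
    have hPv : ∀ t ∈ Icc 0 m, ((P t : Icc (0 : ℝ) L) : ℝ) = t := fun t ht => by
      rw [hP, projIcc_of_mem hL0 ⟨ht.1, hlen t ht⟩]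
    have hm1 : m ∈ Icc 0 m := ⟨hm, le_rfl⟩
    have h00 : (0 : ℝ) ∈ Icc 0 m := ⟨le_rfl, hm⟩
    refine ⟨(m, BoundedContinuousFunction.mkOfCompact ⟨fun t : Icc 0 L => g (clamp 0 m t),
      hcl.continuous.comp continuous_subtype_val⟩), ⟨⟨⟨hm, hlen m hm1⟩, ?_, ?_⟩, ?_, ?_⟩, ?_⟩
    · exact fun t => hmem _ (clamp_mem hm _)
    · intro s t
      have := hcl.dist_le s t
      rwa [← Real.dist_eq] at this
    · simp only [mkOfCompact_apply, ContinuousMap.coe_mk]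
      rw [hPv 0 h00, clamp_of_mem h00, h0]
    · simp only [mkOfCompact_apply, ContinuousMap.coe_mk]
      rw [hPv m hm1, clamp_of_mem hm1, h1]
    · refine intervalIntegral.integral_congr fun t ht => ?_
      rw [uIcc_of_le hm] at ht
      simp only [mkOfCompact_apply, ContinuousMap.coe_mk]
      rw [hPv t ht, clamp_of_mem ht, max_eq_right (hbd t ht)]
  obtain ⟨c₁, hc₁, hc₁'⟩ := exists_lt_of_csInf_lt (hΩ.costSet_nonempty hx hy)
    (lt_add_one (kd Ω x y))
  obtain ⟨p₁, hp₁, hp₁'⟩ := key c₁ hc₁ hc₁'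
  obtain ⟨⟨m, f⟩, hpK, hmin⟩ := hKc.exists_isMinOn ⟨p₁, hp₁⟩ hΦc.continuousOn
  obtain ⟨⟨hm, hf1, hf2⟩, hf3, hf4⟩ := hpK
  have hle : Φ (m, f) ≤ κ := by
    refine le_csInf (hΩ.costSet_nonempty hx hy) fun c' hc' => ?_
    rcases lt_or_ge c' (κ + 1) with h | h
    · obtain ⟨p, hp, rfl⟩ := key c' hc' h
      exact hmin hp
    · exact (hmin hp₁).trans (hp₁'.le.trans (hc₁'.le.trans h))
  refine ⟨fun t => f (P t), m, ⟨hm.1, .of_dist_le (fun s t => ?_) fun t => hFΩ (hf1 _), ?_⟩,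
    hf3, hf4⟩
  · refine (hf2 _ _).trans ?_
    simpa [Real.dist_eq] using (LipschitzWith.projIcc hL0).dist_le_mul s t
  · simp only [hf3]
    rw [show f (P m) = y from hf4, ← hκ]
    refine le_of_eq_of_le ?_ hle
    refine intervalIntegral.integral_congr fun t _ => ?_
    simp only [max_eq_right (show c ≤ bdist Ω (f (P t)) from (hf1 _).2)]

/-! ### Arc length: passing between paths and Lipschitz curves -/

/-- The length of the part of `γ` before the parameter `u`. -/
def arcLength {x y : E} (γ : Path x y) (u : I) : ℝ := variationOnFromTo γ univ 0 u

section arcLength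

variable {x y : E} {γ : Path x y}

theorem Rectifiable.locallyBounded (hγ : Rectifiable γ) : LocallyBoundedVariationOn γ univ :=
  BoundedVariationOn.locallyBoundedVariationOn hγ

theorem Rectifiable.arcLength_sub (hγ : Rectifiable γ) {u w : I} (huw : u ≤ w) :
    arcLength γ w - arcLength γ u = (lengthOn γ (Icc u w)).toReal := by
  unfold arcLength lengthOn
  rw [variationOnFromTo.sub_right hγ.locallyBounded (mem_univ _) (mem_univ _) (mem_univ _),
    variationOnFromTo.eq_of_le _ _ huw, univ_inter]

theorem arcLength_zero : arcLength γ 0 = 0 := variationOnFromTo.self _ _ _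

theorem arcLength_one : arcLength γ 1 = (len γ).toReal := by
  unfold arcLength len lengthOn
  rw [variationOnFromTo.eq_of_le _ _ zero_le_one, univ_inter]
  congr
  exact Icc_bot_top

theorem Rectifiable.arcLength_mono (hγ : Rectifiable γ) : Monotone (arcLength γ) := fun u w huw =>
  variationOnFromTo.monotoneOn hγ.locallyBounded (mem_univ _) (mem_univ u) (mem_univ w) huw

theorem Rectifiable.continuous_arcLength (hγ : Rectifiable γ) : Continuous (arcLength γ) := by
  refine continuous_iff_continuousAt.2 fun b =>
    continuousAt_iff_continuous_left'_right'.2 ⟨?_, ?_⟩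
  · have := variationOnFromTo.tendsto_left (f := γ) (s := univ) (a := 0) (b := b) (l := γ b)
      (mem_univ _) (mem_univ _) hγ.locallyBounded
      (γ.continuous.continuousAt.tendsto.mono_left nhdsWithin_le_nhds)
    simpa [ContinuousWithinAt] using! this
  · have := variationOnFromTo.tendsto_right (f := γ) (s := univ) (a := 0) (b := b) (l := γ b)
      (mem_univ _) (mem_univ _) hγ.locallyBounded
      (γ.continuous.continuousAt.tendsto.mono_left nhdsWithin_le_nhds)
    simpa [ContinuousWithinAt] using! this

theorem Rectifiable.exists_arcLength_eq (hγ : Rectifiable γ) {s : ℝ}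
    (hs : s ∈ Icc 0 (len γ).toReal) : ∃ u, arcLength γ u = s :=
  mem_range_of_exists_le_of_exists_ge hγ.continuous_arcLength ⟨0, arcLength_zero.trans_le hs.1⟩
    ⟨1, hs.2.trans_eq arcLength_one.symm⟩

theorem Rectifiable.naturalParameterization_arcLength (hγ : Rectifiable γ) (u : I) :
    naturalParameterization γ univ (0 : I) (arcLength γ u) = γ u :=
  edist_eq_zero.1 (edist_naturalParameterization_eq_zero hγ.locallyBounded (mem_univ _)
    (mem_univ u))

end arcLength

theorem ofReal_qcost (hΩ : ProperDomain Ω) {g : ℝ → E} (hg : IsCurve Ω g) {l : ℝ} (hl : 0 ≤ l) :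
    ENNReal.ofReal (qcost Ω g 0 l) = ∫⁻ s in Icc 0 l, ENNReal.ofReal (bdist Ω (g s))⁻¹ := by
  unfold qcost
  rw [intervalIntegral.integral_of_le hl, ← integral_Icc_eq_integral_Ioc,
    ofReal_integral_eq_lintegral_ofReal]
  · exact (hg.continuous_inv_bdist hΩ).integrableOn_Icc
  · exact Eventually.of_forall fun t => (inv_pos.2 (hΩ.bdist_pos (hg.mem t))).le

/-- The arc length parametrization of a rectifiable path. -/
theorem Rectifiable.exists_isCurve (hΩ : ProperDomain Ω) {x y : E} {γ : Path x y}
    (hγ : Rectifiable γ) (hin : InSet Ω γ) :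
    ∃ g, IsCurve Ω g ∧ (∀ u, g (arcLength γ u) = γ u) ∧
      qhLength Ω γ = ENNReal.ofReal (qcost Ω g 0 (len γ).toReal) := by
  set l := (len γ).toReal with hl
  have hl0 : 0 ≤ l := ENNReal.toReal_nonneg
  set N := naturalParameterization γ univ (0 : I) with hN
  have hrange : ∀ u, arcLength γ u ∈ Icc 0 l := fun u =>
    ⟨arcLength_zero.symm.trans_le (hγ.arcLength_mono (zero_le : 0 ≤ u)),
      (hγ.arcLength_mono unitInterval.le_one').trans_eq arcLength_one⟩
  -- The natural parametrization is meaningful only on [0, l]; clamping extends it constantly to ℝ.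
  have hg : IsCurve Ω fun t => N (clamp 0 l t) := by
    refine .of_dist_le_of_le (fun s t hst => ?_) fun t => ?_
    · obtain ⟨a, ha⟩ := hγ.exists_arcLength_eq (clamp_mem hl0 s)
      obtain ⟨b, hb⟩ := hγ.exists_arcLength_eq (clamp_mem hl0 t)
      have hle : clamp 0 l s ≤ clamp 0 l t := max_le_max_left _ (min_le_min_left _ hst)
      have h1 := has_unit_speed_naturalParameterization γ hγ.locallyBounded (mem_univ 0)
        ⟨a, mem_univ _, ha⟩ ⟨b, mem_univ _, hb⟩
      have h2 := eVariationOn.edist_le N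
        (s := variationOnFromTo γ univ 0 '' univ ∩ Icc (clamp 0 l s) (clamp 0 l t))
        ⟨⟨a, mem_univ _, ha⟩, ⟨le_rfl, hle⟩⟩ ⟨⟨b, mem_univ _, hb⟩, ⟨hle, le_rfl⟩⟩
      rw [h1, edist_dist, ENNReal.ofReal_le_ofReal_iff (by simpa using hle)] at h2
      refine h2.trans ?_
      have h3 := abs_clamp_sub_le 0 l t s
      rw [abs_of_nonneg (sub_nonneg.2 hst)] at h3
      simpa using (le_abs_self _).trans h3
    · obtain ⟨a, ha⟩ := hγ.exists_arcLength_eq (clamp_mem hl0 t)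
      simp only [← ha, hN, hγ.naturalParameterization_arcLength]
      exact hin a
  refine ⟨_, hg, fun u => ?_, ?_⟩
  · simp only [clamp_of_mem (hrange u)]
    exact hγ.naturalParameterization_arcLength u
  · rw [ofReal_qcost hΩ hg hl0]
    refine setLIntegral_congr_fun measurableSet_Icc fun s hs => ?_
    simp only [one_div]
    rw [clamp_of_mem hs]

/-- The path described by the part of a curve with parameters in `[0, l]`. -/
def IsCurve.toPath {g : ℝ → E} (hg : IsCurve Ω g) (l : ℝ) : Path (g 0) (g l) where
  toFun u := g (l * u)
  continuous_toFun := hg.continuous.comp (by fun_prop)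
  source' := by simp
  target' := by simp

section toPath

variable {g : ℝ → E} (hg : IsCurve Ω g) {l : ℝ}

theorem IsCurve.toPath_apply (u : I) : hg.toPath l u = g (l * u) := rfl

theorem IsCurve.inSet_toPath : InSet Ω (hg.toPath l) := fun _ => hg.mem _

theorem IsCurve.lengthOn_toPath_le (hl : 0 ≤ l) (u w : I) :
    lengthOn (hg.toPath l) (Icc u w) ≤ ENNReal.ofReal (l * w - l * u) := by
  have h1 := (hg.lipschitz.lipschitzOnWith (s := univ)).comp_eVariationOn_le
    (g := fun t : I => l * t) (s := Icc u w) (fun _ _ => mem_univ _)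
  have hm : MonotoneOn (fun t : I => l * (t : ℝ)) univ :=
    fun a _ b _ hab => mul_le_mul_of_nonneg_left hab hl
  have h2 := (hm.eVariationOn_eq (mem_univ u) (mem_univ w)).le
  rw [univ_inter] at h2
  refine h1.trans ?_
  simpa using h2

theorem IsCurve.len_toPath_le (hl : 0 ≤ l) : len (hg.toPath l) ≤ ENNReal.ofReal l := by
  have := hg.lengthOn_toPath_le hl 0 1
  rw [show Icc (0 : I) 1 = univ from Icc_bot_top] at this
  simpa using! this

theorem IsCurve.lengthOn_Iic_toPath_le (hl : 0 ≤ l) (u : I) :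
    lengthOn (hg.toPath l) (Iic u) ≤ ENNReal.ofReal (l * u) := by
  have := hg.lengthOn_toPath_le hl 0 u
  rw [show Icc (0 : I) u = Iic u from Icc_bot] at this
  simpa using! this

theorem IsCurve.lengthOn_Ici_toPath_le (hl : 0 ≤ l) (u : I) :
    lengthOn (hg.toPath l) (Ici u) ≤ ENNReal.ofReal (l - l * u) := by
  have := hg.lengthOn_toPath_le hl u 1
  rw [show Icc u (1 : I) = Ici u from Icc_top] at this
  simpa using! this

theorem IsCurve.rectifiable_toPath (hl : 0 ≤ l) : Rectifiable (hg.toPath l) :=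
  ne_top_of_le_ne_top ENNReal.ofReal_ne_top (hg.len_toPath_le hl)

end toPath

/-- A `1`-Lipschitz change of variables onto an interval does not increase integrals. -/
theorem setLIntegral_le_of_lipschitz {w : ℝ → ℝ} (hw : LipschitzWith 1 w) {s t : Set ℝ}
    (hst : SurjOn w s t)
    {f : ℝ → ℝ≥0∞} (hf : Measurable f) :
    ∫⁻ r in t, f r ≤ ∫⁻ r in s, f (w r) := by
  have hwm : Measurable w := hw.continuous.measurable
  -- Lebesgue measure on the line is one-dimensional Hausdorff measure, which does not increase
  -- under 1-Lipschitz maps.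
  have hle : volume.restrict t ≤ Measure.map w (volume.restrict s) := by
    refine Measure.le_iff.2 fun B hB => ?_
    rw [Measure.map_apply hwm hB, Measure.restrict_apply hB, Measure.restrict_apply (hwm hB)]
    have hsub : B ∩ t ⊆ w '' (w ⁻¹' B ∩ s) := by
      rintro b ⟨hb, hbt⟩
      obtain ⟨a, ha, rfl⟩ := hst hbt
      exact ⟨a, ⟨hb, ha⟩, rfl⟩
    refine (measure_mono hsub).trans ?_
    have := (hw.lipschitzOnWith (s := w ⁻¹' B ∩ s)).hausdorffMeasure_image_le (d := 1) zero_le_one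
    rw [hausdorffMeasure_real] at this
    simpa using this
  calc ∫⁻ r in t, f r ≤ ∫⁻ r, f r ∂(Measure.map w (volume.restrict s)) := lintegral_mono' hle le_rfl
    _ = ∫⁻ r in s, f (w r) := lintegral_map hf hwm

/-- A 1-Lipschitz curve may run below unit speed, so its cost can only exceed the one measured by
arc length. Indeed g = h ∘ w on [0, l], with h the arc length parametrization and w the 1-Lipschitz
arc length function. -/
theorem IsCurve.qhLength_toPath_le (hΩ : ProperDomain Ω) {g : ℝ → E} (hg : IsCurve Ω g) {l : ℝ}
    (hl : 0 ≤ l) : qhLength Ω (hg.toPath l) ≤ ENNReal.ofReal (qcost Ω g 0 l) := by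
  have hr := hg.rectifiable_toPath hl
  obtain ⟨h, hh, hhv, hcost⟩ := hr.exists_isCurve hΩ hg.inSet_toPath
  set m := (len (hg.toPath l)).toReal with hm
  have hm0 : 0 ≤ m := ENNReal.toReal_nonneg
  have hml : m ≤ l := ENNReal.toReal_le_of_le_ofReal hl (hg.len_toPath_le hl)
  rcases eq_or_lt_of_le hl with rfl | hl
  · rw [hcost, le_antisymm hml hm0]
    simp [qcost]
  set w : ℝ → ℝ := fun t => arcLength (hg.toPath l) (projIcc 0 1 zero_le_one (t / l)) with hw
  have hwL : LipschitzWith 1 w := by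
    refine LipschitzWith.of_le_add_mul 1 fun s t => ?_
    rcases le_total s t with hst | hst
    · have : w s ≤ w t := hr.arcLength_mono (monotone_projIcc _ (by gcongr))
      have := dist_nonneg (x := s) (y := t)
      push_cast
      linarith
    · have hpr : projIcc 0 1 zero_le_one (t / l) ≤ projIcc (0 : ℝ) 1 zero_le_one (s / l) :=
        monotone_projIcc _ (by gcongr)
      have h1 := hr.arcLength_sub hpr
      have h2 := ENNReal.toReal_le_of_le_ofReal
        (sub_nonneg.2 (mul_le_mul_of_nonneg_left hpr hl.le)) (hg.lengthOn_toPath_le hl.le _ _)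
      have h3 := (LipschitzWith.projIcc (zero_le_one (α := ℝ))).dist_le_mul (s / l) (t / l)
      rw [Subtype.dist_eq, Real.dist_eq, Real.dist_eq, ← sub_div, abs_div, abs_of_pos hl,
        abs_of_nonneg (sub_nonneg.2 hst), NNReal.coe_one, one_mul, le_div_iff₀ hl] at h3
      have h4 := le_abs_self ((projIcc (0 : ℝ) 1 zero_le_one (s / l) : ℝ)
        - (projIcc (0 : ℝ) 1 zero_le_one (t / l) : ℝ))
      rw [Real.dist_eq, abs_of_nonneg (sub_nonneg.2 hst), NNReal.coe_one, one_mul]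
      have h5 := mul_le_mul_of_nonneg_left h4 hl.le
      have h6 : w s - w t ≤ _ := h1.le.trans h2
      linarith
  have hwg : ∀ t ∈ Icc 0 l, h (w t) = g t := fun t ht => by
    have h1 : t / l ∈ Icc (0 : ℝ) 1 := ⟨div_nonneg ht.1 hl.le, (div_le_one hl).2 ht.2⟩
    simp only [hw, hhv, IsCurve.toPath_apply, projIcc_of_mem zero_le_one h1]
    rw [mul_div_cancel₀ _ hl.ne']
  have hsurj : SurjOn w (Icc 0 l) (Icc 0 m) := by
    have h0 : w 0 = 0 := by simp [hw, arcLength_zero]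
    have h1 : w l = m := by
      simp only [hw, div_self hl.ne', hm, ← arcLength_one]
      exact congrArg _ (projIcc_right (h := zero_le_one (α := ℝ)))
    have := intermediate_value_Icc hl.le hwL.continuous.continuousOn
    rwa [h0, h1] at this
  rw [hcost, ofReal_qcost hΩ hh hm0, ofReal_qcost hΩ hg hl.le]
  refine (setLIntegral_le_of_lipschitz hwL hsurj
    (hh.continuous_inv_bdist hΩ).measurable.ennreal_ofReal).trans_eq ?_
  exact setLIntegral_congr_fun measurableSet_Icc fun t ht => by simp only [hwg t ht]

theorem Rectifiable.ofReal_kd_le (hΩ : ProperDomain Ω) {x y : E} {γ : Path x y}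
    (hγ : Rectifiable γ) (hin : InSet Ω γ) : ENNReal.ofReal (kd Ω x y) ≤ qhLength Ω γ := by
  obtain ⟨g, hg, hgv, hcost⟩ := hγ.exists_isCurve hΩ hin
  rw [hcost]
  refine ENNReal.ofReal_le_ofReal ?_
  have := hg.kd_le hΩ (a := 0) (b := (len γ).toReal) ENNReal.toReal_nonneg
  rwa [← arcLength_one, hgv, ← arcLength_zero (γ := γ), hgv, γ.source, γ.target, arcLength_zero,
    arcLength_one] at this

theorem IsMinimal.isQHGeodesic (hΩ : ProperDomain Ω) {g : ℝ → E} {l : ℝ} (hg : IsMinimal Ω g l) :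
    IsQHGeodesic Ω (hg.curve.toPath l) := by
  have hr := hg.curve.rectifiable_toPath hg.nonneg
  have hin : InSet Ω (hg.curve.toPath l) := hg.curve.inSet_toPath
  refine ⟨hin, hr, le_antisymm ?_ ?_⟩
  · refine (hg.curve.qhLength_toPath_le hΩ hg.nonneg).trans
      ((ENNReal.ofReal_le_ofReal hg.qcost_le).trans ?_)
    exact le_iInf fun γ => le_iInf fun h1 => le_iInf fun h2 => h2.ofReal_kd_le hΩ h1
  · exact iInf_le_of_le _ (iInf_le_of_le hin (iInf_le_of_le hr le_rfl))

/-- The arc length parametrization works, since every Lipschitz competitor yields a path of no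
larger quasihyperbolic length. The parameter interval has exactly the length of γ, so length bounds
for minimal curves carry over to γ. -/
theorem IsQHGeodesic.exists_isMinimal (hΩ : ProperDomain Ω) {x y : E} {γ : Path x y}
    (hγ : IsQHGeodesic Ω γ) :
    ∃ g, IsMinimal Ω g (len γ).toReal ∧ g 0 = x ∧ g (len γ).toReal = y := by
  obtain ⟨hin, hr, hmin⟩ := hγ
  obtain ⟨g, hg, hgv, hcost⟩ := hr.exists_isCurve hΩ hin
  have h0 : g 0 = x := by rw [← arcLength_zero (γ := γ), hgv, γ.source]
  have h1 : g (len γ).toReal = y := by rw [← arcLength_one, hgv, γ.target]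
  refine ⟨g, ⟨ENNReal.toReal_nonneg, hg, ?_⟩, h0, h1⟩
  rw [h0, h1]
  have hx : x ∈ Ω := h0 ▸ hg.mem 0
  have hy : y ∈ Ω := h1 ▸ hg.mem _
  refine le_csInf (hΩ.costSet_nonempty hx hy) ?_
  rintro _ ⟨h, m, hh, hm, rfl, rfl, rfl⟩
  have h2 : qhDist Ω (h 0) (h m) ≤ qhLength Ω (hh.toPath m) :=
    iInf_le_of_le _ (iInf_le_of_le hh.inSet_toPath (iInf_le_of_le (hh.rectifiable_toPath hm) le_rfl))
  rw [← hmin, hcost] at h2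
  exact (ENNReal.ofReal_le_ofReal_iff (hh.qcost_nonneg hΩ hm)).1
    (h2.trans (hh.qhLength_toPath_le hΩ hm))

/-! ### Volume packing and the diameter cigar condition -/

/-- A bound for the number of `δ`-separated points in a ball of radius `R`. -/
theorem natCast_le_of_separated [FiniteDimensional ℝ E] {m : ℕ} {f : ℕ → E} {c : E} {R δ : ℝ}
    (hR : 0 ≤ R) (hδ : 0 < δ) (hf : ∀ i < m, dist (f i) c ≤ R)
    (hsep : ∀ i j, i < j → j < m → δ ≤ dist (f i) (f j)) :
    (m : ℝ) ≤ (1 + 2 * R / δ) ^ Module.finrank ℝ E := by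
  borelize E
  let μ : Measure E := Measure.addHaar
  set n := Module.finrank ℝ E
  have hδ2 : 0 < δ / 2 := by positivity
  have hρ : 0 < R + δ / 2 := by positivity
  have hdisj : Set.Pairwise (Finset.range m : Set ℕ)
      (Function.onFun Disjoint fun i => ball (f i) (δ / 2)) := by
    intro i hi j hj hij
    simp only [Finset.coe_range, mem_Iio] at hi hj
    refine ball_disjoint_ball ?_
    rw [add_halves]
    rcases lt_or_gt_of_ne hij with h | h
    · exact hsep i j h hj
    · rw [dist_comm]; exact hsep j i h hi
  have hsub : (⋃ i ∈ Finset.range m, ball (f i) (δ / 2)) ⊆ ball c (R + δ / 2) := by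
    refine iUnion₂_subset fun i hi => ball_subset_ball' ?_
    linarith [hf i (Finset.mem_range.1 hi)]
  have h1 := measure_mono (μ := μ) hsub
  rw [measure_biUnion_finset hdisj fun _ _ => measurableSet_ball] at h1
  simp only [μ.addHaar_ball_of_pos _ hδ2, μ.addHaar_ball_of_pos _ hρ, Finset.sum_const,
    Finset.card_range, nsmul_eq_mul, ← mul_assoc] at h1
  rw [ENNReal.mul_le_mul_iff_left (measure_ball_pos _ _ zero_lt_one).ne' measure_ball_lt_top.ne,
    ← ENNReal.ofReal_natCast, ← ENNReal.ofReal_mul (Nat.cast_nonneg m),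
    ENNReal.ofReal_le_ofReal_iff (by positivity), ← le_div_iff₀ (by positivity), ← div_pow] at h1
  have h2 : (R + δ / 2) / (δ / 2) = 1 + 2 * R / δ := by
    field_simp
    ring
  rwa [h2] at h1

/-- At each point, one of the two halves of the curve lies in a ball of radius comparable with the
distance to the boundary. -/
def DiamCigar (Ω : Set E) (A : ℝ) (g : ℝ → E) (l : ℝ) : Prop :=
  ∀ t ∈ Icc 0 l, (∀ a ∈ Icc 0 t, dist (g a) (g t) ≤ A * bdist Ω (g t)) ∨
    ∀ b ∈ Icc t l, dist (g b) (g t) ≤ A * bdist Ω (g t)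

theorem edist_le_innerDist (Ω : Set E) (x y : E) : edist x y ≤ innerDist Ω x y := by
  refine le_iInf fun γ => le_iInf fun _ => le_iInf fun _ => ?_
  have := eVariationOn.edist_le γ (mem_univ 0) (mem_univ (1 : I))
  rwa [γ.source, γ.target] at this

theorem IsMinimal.diamCigar (hΩ : ProperDomain Ω) {c₀ C : ℝ} (hc₀ : 0 < c₀) (hC : 0 < C)
    (hLLC : LLC2 Ω c₀) (hsep : BallSeparation Ω C) {g : ℝ → E} {l : ℝ} (hg : IsMinimal Ω g l) :
    DiamCigar Ω (c₀ * C) g l := by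
  intro t ht
  by_contra! hcon
  obtain ⟨⟨a, ha, hat⟩, b, hb, hbt⟩ := hcon
  have hd := hΩ.bdist_pos (hg.curve.mem t)
  have hout : ∀ s, c₀ * C * bdist Ω (g t) < dist (g s) (g t) →
      g s ∈ Ω \ closure (ball (g t) (c₀ * C * bdist Ω (g t))) := fun s hs =>
    ⟨hg.curve.mem s, fun h => absurd (closure_ball_subset_closedBall h) (not_le.2 hs)⟩
  obtain ⟨α, hα⟩ := hLLC (g t) (hg.curve.mem t) _ (by positivity) _ (hout a hat) _ (hout b hbt)
  have hmin := hg.sub hΩ ha.1 (ha.2.trans hb.1) hb.2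
  -- Ball separation is applied to the part of g over [a, b], which passes through g t, and to the
  -- LLC-2 curve.
  obtain ⟨w, ⟨-, hw⟩, u, rfl⟩ := hsep _ (hmin.isQHGeodesic hΩ) (g t)
    (by
      have hab : 0 ≤ b - a := by linarith [ha.2, hb.1]
      rcases eq_or_lt_of_le hab with h | h
      · refine ⟨0, ?_⟩
        rw [Path.source]
        congr 1
        linarith [ha.2, hb.1]
      · refine ⟨⟨(t - a) / (b - a), div_nonneg (by linarith [ha.2]) hab,
          (div_le_one h).2 (by linarith [hb.1])⟩, ?_⟩
        simp only [IsCurve.toPath_apply]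
        congr 1
        rw [mul_div_cancel₀ _ h.ne']
        ring)
    (α.cast (by simp) (by simp)) fun u => (hα u).1
  refine (hα u).2 (subset_closure ?_)
  have h1 := (edist_le_innerDist Ω (g t) _).trans_lt hw
  rw [edist_dist, ENNReal.ofReal_lt_ofReal_iff (by positivity)] at h1
  rw [mem_ball, dist_comm]
  rwa [show c₀ * C * bdist Ω (g t) / c₀ = C * bdist Ω (g t) by field_simp]

/-- Let p be a boundary point nearest to z, and join z to the point at distance d/4 from p on the
segment. The geodesic crosses the sphere of radius d/2 about p at a point of height at most d/2,
whose distance to either end is at least d/4. The final numerical estimates need this lower bound on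
A. -/
theorem half_le_of_diamCigar [ProperSpace E] (hΩ : ProperDomain Ω) {A : ℝ} (hA : 0 < A)
    (hcig : ∀ g l, IsMinimal Ω g l → DiamCigar Ω A g l) : 1 / 2 ≤ A := by
  obtain ⟨z, hz⟩ := hΩ.isConnected.nonempty
  have hd := hΩ.bdist_pos hz
  obtain ⟨p, hp, hzp⟩ := isClosed_frontier.exists_infDist_eq_dist hΩ.frontier_nonempty z
  set d := bdist Ω z with hdd
  have hzp : dist z p = d := hzp.symm
  set y : E := AffineMap.lineMap p z (1 / 4 : ℝ) with hy
  have hyp : dist y p = d / 4 := by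
    rw [hy, dist_lineMap_left, dist_comm p z, hzp]; norm_num; ring
  have hyz : dist y z = 3 / 4 * d := by
    rw [hy, dist_lineMap_right, dist_comm p z, hzp]; norm_num
  have hyΩ : y ∈ Ω := hΩ.mem_of_dist_lt hz (by rw [hyz]; linarith)
  obtain ⟨g, l, hg, h0, h1⟩ := hΩ.exists_isMinimal hz hyΩ
  obtain ⟨t, ht, hgt⟩ : d / 2 ∈ (fun t => dist (g t) p) '' Icc 0 l := by
    refine intermediate_value_Icc' hg.nonneg
      (hg.curve.continuous.dist continuous_const).continuousOn ⟨?_, ?_⟩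
    · rw [h1, hyp]; linarith
    · rw [h0, hzp]; linarith
  have hgt : dist (g t) p = d / 2 := hgt
  have hb : bdist Ω (g t) ≤ d / 2 := (infDist_le_dist_of_mem hp).trans_eq hgt
  have hAb := mul_le_mul_of_nonneg_left hb hA.le
  rcases hcig g l hg t ht with h | h
  · have h2 := h 0 ⟨le_rfl, ht.1⟩
    rw [h0] at h2
    have := dist_triangle z (g t) p
    nlinarith
  · have h2 := h l ⟨ht.2, le_rfl⟩
    rw [h1] at h2
    have h3 := dist_triangle (g t) y p
    rw [dist_comm (g t) y] at h3
    nlinarith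

/-! ### From the diameter cigar to the length cigar -/

/-- The length of a part of a geodesic in a bounded region away from the boundary. -/
theorem IsMinimal.sub_le_of_bdist_mem [FiniteDimensional ℝ E] (hΩ : ProperDomain Ω) {g : ℝ → E}
    {l : ℝ} (hg : IsMinimal Ω g l) {u t ρ D R : ℝ} {c : E} (hu : 0 ≤ u) (hut : u ≤ t) (ht : t ≤ l)
    (hρ : 0 < ρ) (hρd : ∀ s ∈ Icc u t, ρ ≤ bdist Ω (g s))
    (hD : ∀ s ∈ Icc u t, bdist Ω (g s) ≤ D) (hR : ∀ s ∈ Icc u t, dist (g s) c ≤ R) :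
    t - u ≤ 2 * D * (1 + 4 * R / ρ) ^ Module.finrank ℝ E := by
  have hu' : u ∈ Icc u t := ⟨le_rfl, hut⟩
  have hD0 : 0 < D := hρ.trans_le ((hρd u hu').trans (hD u hu'))
  have hR0 : 0 ≤ R := dist_nonneg.trans (hR u hu')
  -- Parameters 2D apart cost at least 2 because heights are at most D, whereas points closer than
  -- ρ/2 have quasihyperbolic distance at most 1. So the m + 1 sample points are ρ/2-separated.
  set m := ⌊(t - u) / (2 * D)⌋₊ with hm
  have hmle : (m : ℝ) * (2 * D) ≤ t - u := by
    rw [← le_div_iff₀ (by positivity)]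
    exact Nat.floor_le (div_nonneg (by linarith) (by positivity))
  have hmem : ∀ i < m + 1, u + 2 * D * i ∈ Icc u t := fun i hi => by
    have hi' : (i : ℝ) ≤ m := by exact_mod_cast Nat.lt_succ_iff.1 hi
    have := mul_le_mul_of_nonneg_right hi' (by positivity : 0 ≤ 2 * D)
    exact ⟨by have : 0 ≤ 2 * D * (i : ℝ) := by positivity
              linarith, by linarith⟩
  have hcard := natCast_le_of_separated (m := m + 1) (f := fun i => g (u + 2 * D * i)) (c := c)
    (δ := ρ / 2) hR0 (by positivity) (fun i hi => hR _ (hmem i hi)) (fun i j hij hj => by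
      by_contra! hlt
      have hi := hmem i (hij.trans hj)
      have hj := hmem j hj
      have h1 := hΩ.kd_le_one (hg.curve.mem (u + 2 * D * i))
        (hlt.le.trans (by linarith [hρd _ hi]))
      have hij' : (i : ℝ) + 1 ≤ j := by exact_mod_cast hij
      have hle : u + 2 * D * i ≤ u + 2 * D * j := by gcongr
      rw [← hg.qcost_eq hΩ (hu.trans hi.1) hle (hj.2.trans ht)] at h1
      have h2 := hg.curve.le_qcost hΩ hle fun s hs => hD s ⟨hi.1.trans hs.1, hs.2.trans hj.2⟩
      have h3 := h2.trans h1
      rw [div_le_one hD0] at h3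
      nlinarith)
  rw [show 2 * R / (ρ / 2) = 4 * R / ρ by field_simp; ring] at hcard
  have hlt := Nat.lt_floor_add_one ((t - u) / (2 * D))
  rw [div_lt_iff₀ (by positivity)] at hlt
  push_cast at hcard
  rw [mul_comm (2 * D)]
  exact hlt.le.trans (mul_le_mul_of_nonneg_right hcard (by positivity))

/-- The constant of the length cigar condition. -/
def cigarConst (n : ℕ) (A : ℝ) : ℝ := 4 * (A + 1) * (1 + 8 * A * (A + 1)) ^ n

theorem IsMinimal.le_cigarConst_mul [FiniteDimensional ℝ E] (hΩ : ProperDomain Ω) {A : ℝ}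
    (hA : 0 < A) {g : ℝ → E} {l : ℝ} (hg : IsMinimal Ω g l) (hcig : DiamCigar Ω A g l) {t : ℝ}
    (ht : t ∈ Icc 0 l) (hhalf : ∀ a ∈ Icc 0 t, dist (g a) (g t) ≤ A * bdist Ω (g t)) :
    t ≤ cigarConst (Module.finrank ℝ E) A * bdist Ω (g t) := by
  set M := cigarConst (Module.finrank ℝ E) A with hM
  have hM0 : 0 < M := by rw [hM, cigarConst]; positivity
  have hdc : Continuous fun t => bdist Ω (g t) := (continuous_bdist Ω).comp hg.curve.continuous
  obtain ⟨s₀, -, hs₀⟩ := isCompact_Icc.exists_isMinOn (nonempty_Icc.2 hg.nonneg) hdc.continuousOn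
  have hδ := hΩ.bdist_pos (hg.curve.mem s₀)
  set δ := bdist Ω (g s₀)
  -- Induction over dyadic heights above the minimal height δ, so the case k = 0 is void.
  have main : ∀ k : ℕ, ∀ t ∈ Icc 0 l, bdist Ω (g t) < 2 ^ k * δ →
      (∀ a ∈ Icc 0 t, dist (g a) (g t) ≤ A * bdist Ω (g t)) → t ≤ M * bdist Ω (g t) := by
    intro k
    induction k with
    | zero =>
      intro t ht hlt _
      have : δ ≤ bdist Ω (g t) := hs₀ ht
      linarith
    | succ k ih =>
      intro t ht hlt hhalf
      set r := bdist Ω (g t) with hr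
      have hr0 : 0 < r := hΩ.bdist_pos (hg.curve.mem t)
      have hpack : ∀ u, 0 ≤ u → u ≤ t → (∀ s ∈ Icc u t, r / (2 * (A + 1)) ≤ bdist Ω (g s)) →
          t - u ≤ M / 2 * r := by
        intro u hu hut hlow
        have := hg.sub_le_of_bdist_mem hΩ (D := (A + 1) * r) (R := A * r) (c := g t) hu hut ht.2
          (by positivity) hlow (fun s hs => by
            have h1 := bdist_le_add Ω (g s) (g t)
            have h2 := hhalf s ⟨hu.trans hs.1, hs.2⟩
            linarith) fun s hs => hhalf s ⟨hu.trans hs.1, hs.2⟩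
        refine this.trans_eq ?_
        rw [hM, cigarConst, show 4 * (A * r) / (r / (2 * (A + 1))) = 8 * A * (A + 1) by
          field_simp; ring]
        ring
      set S := Icc 0 t ∩ {s | bdist Ω (g s) ≤ r / (2 * (A + 1))} with hS
      have hSc : IsCompact S := isCompact_Icc.inter_right (isClosed_le hdc continuous_const)
      rcases S.eq_empty_or_nonempty with hSe | hSn
      · have := hpack 0 le_rfl ht.1 fun s hs => by
          by_contra! h
          exact (hSe ▸ (⟨hs, h.le⟩ : s ∈ S) : s ∈ (∅ : Set ℝ))
        have : 0 < M * r := by positivity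
        linarith
      -- Here v is the last time of low height. The half near g v must be the initial one: otherwise
      -- g t would lie within A·d(g v) of g v and have height at most r/2. Induction bounds v by
      -- Mr/2, and packing bounds t - v by Mr/2.
      · obtain ⟨v, ⟨hv, hvd⟩, hvmax⟩ := hSc.exists_isGreatest hSn
        have hvd : bdist Ω (g v) ≤ r / (2 * (A + 1)) := hvd
        have hvd' : (A + 1) * bdist Ω (g v) ≤ r / 2 := by
          rw [le_div_iff₀ (by positivity)] at hvd
          linarith
        have hvb := hΩ.bdist_pos (hg.curve.mem v)
        have hvl : v ∈ Icc 0 l := ⟨hv.1, hv.2.trans ht.2⟩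
        have hvhalf : ∀ a ∈ Icc 0 v, dist (g a) (g v) ≤ A * bdist Ω (g v) := by
          rcases hcig v hvl with h | h
          · exact h
          · have h1 := h t ⟨hv.2, ht.2⟩
            have h2 := bdist_le_add Ω (g t) (g v)
            linarith
        have hv2 : bdist Ω (g v) ≤ r / 2 := by nlinarith
        have h1 := ih v hvl (by rw [pow_succ] at hlt; linarith) hvhalf
        have h2 : t - v ≤ M / 2 * r := by
          by_contra! hcon
          have h3 : 0 < M / 2 * r := by positivity
          -- The lower height bound holds only strictly after v, so packing starts at a time past v
          -- that is still more than Mr/2 before t.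
          have h4 := hpack ((v + (t - M / 2 * r)) / 2) (by linarith [hv.1]) (by linarith)
            fun s hs => by
              by_contra! h
              have := hvmax ⟨⟨by linarith [hs.1, hv.1], hs.2⟩, h.le⟩
              linarith [hs.1]
          linarith
        have h3 := mul_le_mul_of_nonneg_left hv2 hM0.le
        linarith
  obtain ⟨k, hk⟩ := pow_unbounded_of_one_lt (bdist Ω (g t) / δ) one_lt_two
  exact main k t ht ((div_lt_iff₀ hδ).1 hk) hhalf

/-- At each point of a geodesic, the shorter of the two parts has length at most `M` times the
distance to the boundary. -/
def LengthCigar (Ω : Set E) (M : ℝ) : Prop :=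
  ∀ g l, IsMinimal Ω g l → ∀ t ∈ Icc 0 l, t ≤ M * bdist Ω (g t) ∨ l - t ≤ M * bdist Ω (g t)

theorem lengthCigar_of_diamCigar [FiniteDimensional ℝ E] (hΩ : ProperDomain Ω) {A : ℝ}
    (hA : 0 < A) (hcig : ∀ g l, IsMinimal Ω g l → DiamCigar Ω A g l) :
    LengthCigar Ω (cigarConst (Module.finrank ℝ E) A) := by
  intro g l hg t ht
  rcases hcig g l hg t ht with h | h
  · exact Or.inl (hg.le_cigarConst_mul hΩ hA (hcig g l hg) ht h)
  · right
    have := hg.reverse.le_cigarConst_mul hΩ hA (hcig _ l hg.reverse) (t := l - t)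
      ⟨by linarith [ht.2], by linarith [ht.1]⟩ fun a ha => by
        simpa using h (l - a) ⟨by linarith [ha.2], by linarith [ha.1]⟩
    simpa using this

/-! ### Lifting chains away from the boundary -/

/-- The factor by which a lift raises the distance to the boundary. -/
def liftFactor (M : ℝ) : ℝ := 2 * (M + 1)

/-- A bound for the quasihyperbolic distance between a point and its lift. -/
def liftCost (M : ℝ) : ℝ := M * (M + 1) * liftFactor M

/-- The point `x'` is obtained from `x` by moving away from the boundary up to height
`liftFactor M * s`. -/
structure IsLift (Ω : Set E) (M s : ℝ) (x x' : E) : Prop where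
  mem : x' ∈ Ω
  le_bdist : liftFactor M * s ≤ bdist Ω x'
  kd_le : kd Ω x x' ≤ liftCost M
  dist_le : dist x x' ≤ M * liftFactor M * s
  eq_of_le : liftFactor M * s ≤ bdist Ω x → x' = x

theorem liftFactor_pos {M : ℝ} (hM : 1 ≤ M) : 0 < liftFactor M := by unfold liftFactor; linarith

theorem liftCost_pos {M : ℝ} (hM : 1 ≤ M) : 0 < liftCost M := by
  have := liftFactor_pos hM
  unfold liftCost; positivity

theorem IsLift.refl (hΩ : ProperDomain Ω) {M s : ℝ} (hM : 1 ≤ M) (hs : 0 < s) {x : E} (hx : x ∈ Ω)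
    (h : liftFactor M * s ≤ bdist Ω x) : IsLift Ω M s x x where
  mem := hx
  le_bdist := h
  kd_le := (hΩ.kd_self hx).trans_le (liftCost_pos hM).le
  dist_le := by
    have := liftFactor_pos hM
    rw [dist_self]; positivity
  eq_of_le _ := rfl

/-- Unless x is already high enough, follow a geodesic towards the high point z until height Ts is
first reached. Before that time the cigar condition cannot refer to the end z, as z is too high, so
u ≤ M·d(g u). This bounds the length by MTs and keeps the height above s/(M + 1). -/
theorem LengthCigar.exists_isLift [ProperSpace E] (hΩ : ProperDomain Ω) {M s : ℝ} (hM : 1 ≤ M)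
    (hcig : LengthCigar Ω M) (hs : 0 < s) {x z : E} (hx : x ∈ Ω) (hz : z ∈ Ω)
    (hsx : s ≤ bdist Ω x) (hsz : (M + 1) * (liftFactor M * s) < bdist Ω z) :
    ∃ x', IsLift Ω M s x x' := by
  have hT := liftFactor_pos hM
  set T := liftFactor M with hTdef
  rcases le_or_gt (T * s) (bdist Ω x) with h | h
  · exact ⟨x, .refl hΩ hM hs hx h⟩
  obtain ⟨g, l, hg, h0, h1⟩ := hΩ.exists_isMinimal hx hz
  have hdc : Continuous fun t => bdist Ω (g t) := (continuous_bdist Ω).comp hg.curve.continuous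
  have hTs : 0 < T * s := by positivity
  have hTz : T * s ≤ bdist Ω z := by nlinarith
  obtain ⟨t, ⟨ht, htT⟩, hmin⟩ := (isCompact_Icc.inter_right
    (isClosed_le continuous_const hdc) :
    IsCompact (Icc 0 l ∩ {t | T * s ≤ bdist Ω (g t)})).exists_isLeast
      ⟨l, ⟨hg.nonneg, le_rfl⟩, by rw [mem_ofPred_eq, h1]; exact hTz⟩
  have htT : T * s ≤ bdist Ω (g t) := htT
  have hlt : ∀ u ∈ Ico 0 t, bdist Ω (g u) < T * s := fun u hu => by
    by_contra! hcon
    exact absurd (hmin ⟨⟨hu.1, hu.2.le.trans ht.2⟩, hcon⟩) (not_le.2 hu.2)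
  have hle : ∀ u ∈ Icc 0 t, bdist Ω (g u) ≤ T * s := by
    have h0t : (0 : ℝ) < t := by
      rcases eq_or_lt_of_le ht.1 with h' | h'
      · rw [← h', h0] at htT
        linarith
      · exact h'
    have hcl : Icc 0 t ⊆ closure (Ico 0 t) := (closure_Ico h0t.ne).ge
    exact fun u hu => closure_minimal (fun v hv => (hlt v hv).le)
      (isClosed_le hdc continuous_const) (hcl hu)
  have hcarrot : ∀ u ∈ Icc 0 t, u ≤ M * bdist Ω (g u) := fun u hu => by
    rcases hcig g l hg u ⟨hu.1, hu.2.trans ht.2⟩ with h' | h'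
    · exact h'
    · have h2 := bdist_le_add Ω (g l) (g u)
      have h3 := hg.curve.dist_le l u
      rw [abs_of_nonneg (by linarith [hu.2, ht.2])] at h3
      have h4 := hle u hu
      rw [h1] at h2 h3
      nlinarith
  have hlow : ∀ u ∈ Icc 0 t, s / (M + 1) ≤ bdist Ω (g u) := fun u hu => by
    have h2 := bdist_le_add Ω (g 0) (g u)
    have h3 := hg.curve.dist_le 0 u
    rw [zero_sub, abs_neg, abs_of_nonneg hu.1] at h3
    have h4 := hcarrot u hu
    rw [h0] at h2 h3
    rw [div_le_iff₀ (by linarith)]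
    linarith
  have htM : t ≤ M * (T * s) := (hcarrot t ⟨ht.1, le_rfl⟩).trans
    (mul_le_mul_of_nonneg_left (hle t ⟨ht.1, le_rfl⟩) (by linarith))
  refine ⟨g t, hg.curve.mem t, htT, ?_, ?_, fun h' => absurd h' (not_le.2 h)⟩
  · have h2 := hg.curve.kd_le hΩ ht.1
    rw [h0] at h2
    refine h2.trans ((hg.curve.qcost_le hΩ ht.1 (by positivity) hlow).trans ?_)
    rw [sub_zero, div_le_iff₀ (by positivity), liftCost, ← hTdef]
    refine htM.trans_eq ?_
    field_simp
  · have h3 := hg.curve.dist_le 0 t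
    rw [zero_sub, abs_neg, abs_of_nonneg ht.1, h0] at h3
    linarith

/-- The points of `Ω` in a ball that have distance at least `s` to the boundary. -/
def region (Ω : Set E) (c : E) (s ρ : ℝ) : Set E := {w | w ∈ Ω ∧ s ≤ bdist Ω w ∧ dist w c ≤ ρ}

/-- Two points can be joined by a chain of points in the region with steps of size `s / 4`. -/
def Chain (Ω : Set E) (c : E) (s ρ : ℝ) : E → E → Prop :=
  Relation.ReflTransGen fun w w' => w ∈ region Ω c s ρ ∧ w' ∈ region Ω c s ρ ∧ dist w w' ≤ s / 4

/-- Chains turn a connected set into a discrete object whose points can be lifted one by one,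
without any continuity of the lift. -/
theorem chain_of_isPreconnected {c : E} {s ρ : ℝ} (hs : 0 < s) {S : Set E} (hS : IsPreconnected S)
    (hsub : S ⊆ region Ω c s ρ) {x y : E} (hx : x ∈ S) (hy : y ∈ S) : Chain Ω c s ρ x y := by
  refine hS.induction₂' (Chain Ω c s ρ) (fun x hx => ?_)
    (fun x y z _ _ _ h h' => Relation.ReflTransGen.trans h h') hx hy
  filter_upwards [self_mem_nhdsWithin,
    nhdsWithin_le_nhds (closedBall_mem_nhds x (by positivity : 0 < s / 4))] with y hy hyx
  exact ⟨.single ⟨hsub hx, hsub hy, by rw [dist_comm]; exact hyx⟩,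
    .single ⟨hsub hy, hsub hx, hyx⟩⟩

/-- A bound for the displacement caused by lifting a chain. -/
def liftShift (M : ℝ) : ℝ :=
  M * liftFactor M + (M + 2) * liftFactor M * Real.exp (2 * liftCost M + 1)

theorem liftShift_pos {M : ℝ} (hM : 1 ≤ M) : 0 < liftShift M := by
  have := liftFactor_pos hM
  unfold liftShift; positivity

/-- Points that are both high do not move. Otherwise the lifts have height of order s and bounded
quasihyperbolic distance, so a geodesic joining them has length of order s and supplies the new
chain. -/
theorem LengthCigar.chain_lift_step [ProperSpace E] (hΩ : ProperDomain Ω) {M s ρ : ℝ} (hM : 1 ≤ M)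
    (hcig : LengthCigar Ω M) (hs : 0 < s) {c x y x' y' : E} (hx : x ∈ region Ω c s ρ)
    (hy : y ∈ region Ω c s ρ) (hxy : dist x y ≤ s / 4) (hx' : IsLift Ω M s x x')
    (hy' : IsLift Ω M s y y') : Chain Ω c (2 * s) (ρ + liftShift M * s) x' y' := by
  have hT := liftFactor_pos hM
  have hB := liftShift_pos hM
  have hTdef : liftFactor M = 2 * (M + 1) := rfl
  set T := liftFactor M
  have hTs2 : 2 * s ≤ T * s := mul_le_mul_of_nonneg_right (by linarith) hs.le
  have hBs : 0 < liftShift M * s := by positivity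
  by_cases hboth : T * s ≤ bdist Ω x ∧ T * s ≤ bdist Ω y
  · rw [hx'.eq_of_le hboth.1, hy'.eq_of_le hboth.2]
    exact .single ⟨⟨hx.1, hTs2.trans hboth.1, by linarith [hx.2.2]⟩,
      ⟨hy.1, hTs2.trans hboth.2, by linarith [hy.2.2]⟩, by linarith⟩
  have hdx : bdist Ω x ≤ 2 * (T * s) := by
    rcases not_and_or.1 hboth with h | h
    · linarith
    · have := bdist_le_add Ω x y
      linarith
  have hdx' : bdist Ω x' ≤ (M + 2) * T * s := by
    have h1 := bdist_le_add Ω x' x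
    have h2 := hx'.dist_le
    rw [dist_comm] at h2
    linarith
  obtain ⟨g, l, hg, h0, h1⟩ := hΩ.exists_isMinimal hx'.mem hy'.mem
  have hcost : qcost Ω g 0 l ≤ 2 * liftCost M + 1 := by
    have h2 := hg.qcost_le
    rw [h0, h1] at h2
    have h3 := hΩ.kd_triangle hx'.mem hx.1 hy'.mem
    have h4 := hΩ.kd_triangle hx.1 hy.1 hy'.mem
    have h5 := hΩ.kd_le_one hx.1 (y := y) (by linarith [hx.2.1])
    have h6 := hx'.kd_le
    rw [kd_comm] at h6
    linarith [hy'.kd_le]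
  have hlen : l ≤ (M + 2) * T * s * Real.exp (2 * liftCost M + 1) := by
    have h2 := hg.curve.length_le hΩ hg.nonneg
    rw [h0, sub_zero] at h2
    refine h2.trans (mul_le_mul hdx' ?_ ?_ (by positivity))
    · linarith [Real.exp_le_exp.2 hcost]
    · linarith [Real.add_one_le_exp (qcost Ω g 0 l), hg.curve.qcost_nonneg hΩ hg.nonneg]
  have hsub : g '' Icc 0 l ⊆ region Ω c (2 * s) (ρ + liftShift M * s) := by
    rintro _ ⟨t, ht, rfl⟩
    refine ⟨hg.curve.mem t, ?_, ?_⟩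
    -- The end of the cigar's short side has height at least 2(M + 1)s and at most (M + 1)·d(g t).
    -- This dictates the value of `liftFactor`.
    · have key : (M + 1) * (2 * s) ≤ (M + 1) * bdist Ω (g t) := by
        rcases hcig g l hg t ht with h | h
        · have h2 := bdist_le_add Ω (g 0) (g t)
          have h3 := hg.curve.dist_le 0 t
          rw [zero_sub, abs_neg, abs_of_nonneg ht.1] at h3
          rw [h0] at h2 h3
          have h4 := hx'.le_bdist
          rw [show liftFactor M = 2 * (M + 1) from rfl] at h4
          linarith
        · have h2 := bdist_le_add Ω (g l) (g t)
          have h3 := hg.curve.dist_le l t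
          rw [abs_of_nonneg (by linarith [ht.2])] at h3
          rw [h1] at h2 h3
          have h4 := hy'.le_bdist
          rw [show liftFactor M = 2 * (M + 1) from rfl] at h4
          linarith
      exact le_of_mul_le_mul_left key (by linarith)
    · have h2 := hg.curve.dist_le t 0
      rw [sub_zero, abs_of_nonneg ht.1, h0] at h2
      have h3 := dist_triangle4 (g t) x' x c
      have h4 := hx'.dist_le
      rw [dist_comm] at h4
      have h5 : liftShift M * s =
          M * T * s + (M + 2) * T * s * Real.exp (2 * liftCost M + 1) := by
        unfold liftShift; ring
      linarith [hx.2.2, ht.2]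
  exact chain_of_isPreconnected (by linarith)
    (isPreconnected_Icc.image _ hg.curve.continuous.continuousOn) hsub
    ⟨0, ⟨le_rfl, hg.nonneg⟩, h0⟩ ⟨l, ⟨hg.nonneg, le_rfl⟩, h1⟩

/-- Chains can be lifted away from the boundary. -/
theorem LengthCigar.chain_lift [ProperSpace E] (hΩ : ProperDomain Ω) {M s ρ : ℝ} (hM : 1 ≤ M)
    (hcig : LengthCigar Ω M) (hs : 0 < s) {c x y x' y' z : E} (hz : z ∈ Ω)
    (hsz : (M + 1) * (liftFactor M * s) < bdist Ω z) (hx : x ∈ region Ω c s ρ)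
    (hxy : Chain Ω c s ρ x y) (hx' : IsLift Ω M s x x') (hy' : IsLift Ω M s y y') :
    Chain Ω c (2 * s) (ρ + liftShift M * s) x' y' := by
  induction hxy generalizing y' with
  | refl => exact hcig.chain_lift_step hΩ hM hs hx hx (by rw [dist_self]; positivity) hx' hy'
  | tail _ h ih =>
    obtain ⟨w, hw⟩ := hcig.exists_isLift hΩ hM hs h.1.1 hz h.1.2.1 hsz
    exact Relation.ReflTransGen.trans (ih hw)
      (hcig.chain_lift_step hΩ hM hs h.1 h.2.1 h.2.2 hw hy')

/-- The radius grows by the geometric sum of the displacements. The end points are high enough to be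
their own lifts, so they stay fixed throughout. -/
theorem LengthCigar.chain_lift_iterate [ProperSpace E] (hΩ : ProperDomain Ω) {M s ρ : ℝ}
    (hM : 1 ≤ M) (hcig : LengthCigar Ω M) (hs : 0 < s) {c x y z : E} (hz : z ∈ Ω)
    (hx : x ∈ region Ω c s ρ) (hy : y ∈ region Ω c s ρ) (hxy : Chain Ω c s ρ x y) (k : ℕ)
    (hsz : (M + 1) * (liftFactor M * (2 ^ k * s)) < bdist Ω z)
    (hkx : liftFactor M * (2 ^ k * s) ≤ bdist Ω x) (hky : liftFactor M * (2 ^ k * s) ≤ bdist Ω y) :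
    Chain Ω c (2 ^ k * s) (ρ + liftShift M * (2 ^ k * s - s)) x y := by
  have hT := liftFactor_pos hM
  have hB := liftShift_pos hM
  induction k with
  | zero => simpa using hxy
  | succ k ih =>
    have h2 : (1 : ℝ) ≤ 2 ^ k := one_le_pow₀ one_le_two
    have hle : s ≤ 2 ^ k * s := le_mul_of_one_le_left hs.le h2
    have hstep : liftFactor M * (2 ^ k * s) ≤ liftFactor M * (2 ^ (k + 1) * s) := by
      rw [pow_succ]
      exact mul_le_mul_of_nonneg_left (by linarith) hT.le
    have h3 := hstep.trans hkx
    have h4 := hstep.trans hky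
    have h5 := (mul_le_mul_of_nonneg_left hstep (by linarith : 0 ≤ M + 1)).trans_lt hsz
    have h6 : 0 ≤ liftShift M * (2 ^ k * s - s) := mul_nonneg hB.le (by linarith)
    have h7 : 2 ^ k * s ≤ liftFactor M * (2 ^ k * s) := by
      refine le_mul_of_one_le_left (by positivity) ?_
      unfold liftFactor; linarith
    have := hcig.chain_lift hΩ hM (by positivity) hz h5
      ⟨hx.1, h7.trans h3, by linarith [hx.2.2]⟩ (ih h5 h3 h4)
      (.refl hΩ hM (by positivity) hx.1 h3) (.refl hΩ hM (by positivity) hy.1 h4)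
    convert this using 1
    · rw [pow_succ]; ring
    · rw [pow_succ]; ring

/-- A discrete intermediate value property: each step of the chain changes the distance from x by at
most 1. -/
theorem Chain.exists_kd_mem (hΩ : ProperDomain Ω) {c x y : E} {s ρ : ℝ} (hs : 0 < s)
    (hx : x ∈ region Ω c s ρ) (hxy : Chain Ω c s ρ x y) {τ : ℝ} (h0 : 0 ≤ τ)
    (hτ : τ ≤ kd Ω x y) : ∃ w ∈ region Ω c s ρ, τ ≤ kd Ω x w ∧ kd Ω x w ≤ τ + 1 := by
  induction hxy with
  | refl => exact ⟨x, hx, hτ, by rw [hΩ.kd_self hx.1]; linarith⟩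
  | @tail y z _ h ih =>
    rcases le_or_gt τ (kd Ω x y) with h' | h'
    · exact ih h'
    · have h1 := hΩ.kd_triangle hx.1 h.1.1 h.2.1.1
      have h2 := hΩ.kd_le_one h.1.1 (y := z) (by linarith [h.2.2, h.1.2.1])
      exact ⟨z, h.2.1, hτ, by linarith⟩

/-- Points joined by a chain have bounded quasihyperbolic distance. -/
theorem Chain.kd_le [FiniteDimensional ℝ E] (hΩ : ProperDomain Ω) {c x y : E} {s ρ : ℝ}
    (hs : 0 < s) (hx : x ∈ region Ω c s ρ) (hxy : Chain Ω c s ρ x y) :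
    kd Ω x y ≤ 3 * (1 + 4 * ρ / s) ^ Module.finrank ℝ E := by
  have hρ : 0 ≤ ρ := dist_nonneg.trans hx.2.2
  set m := ⌊kd Ω x y / 3⌋₊ with hm
  have hmle : (m : ℝ) * 3 ≤ kd Ω x y := by
    rw [← le_div_iff₀ (by positivity)]
    exact Nat.floor_le (div_nonneg (hΩ.kd_nonneg _ _) (by positivity))
  have hex : ∀ i : ℕ, ∃ w, i < m + 1 → w ∈ region Ω c s ρ ∧ 3 * (i : ℝ) ≤ kd Ω x w ∧
      kd Ω x w ≤ 3 * i + 1 := fun i => by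
    by_cases hi : i < m + 1
    · have hi' : (i : ℝ) ≤ m := by exact_mod_cast Nat.lt_succ_iff.1 hi
      obtain ⟨w, hw⟩ := hxy.exists_kd_mem hΩ hs hx (τ := 3 * (i : ℝ)) (by positivity) (by linarith)
      exact ⟨w, fun _ => hw⟩
    · exact ⟨x, fun h => absurd h hi⟩
  choose f hf using hex
  have hcard := natCast_le_of_separated (m := m + 1) (f := f) (c := c) (δ := s / 2) hρ
    (by positivity) (fun i hi => (hf i hi).1.2.2) (fun i j hij hj => by
      by_contra! hlt
      obtain ⟨hi1, -, hi3⟩ := hf i (hij.trans hj)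
      obtain ⟨hj1, hj2, -⟩ := hf j hj
      have h1 := hΩ.kd_le_one hi1.1 (y := f j) (hlt.le.trans (by linarith [hi1.2.1]))
      have h2 := hΩ.kd_triangle hx.1 hi1.1 hj1.1
      have hij' : (i : ℝ) + 1 ≤ j := by exact_mod_cast hij
      linarith)
  rw [show 2 * ρ / (s / 2) = 4 * ρ / s by field_simp; ring] at hcard
  have hlt := Nat.lt_floor_add_one (kd Ω x y / 3)
  rw [div_lt_iff₀ (by positivity)] at hlt
  push_cast at hcard
  linarith

/-! ### The Gehring–Hayman inequality and inner uniformity -/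

/-- A bound for the quasihyperbolic distance in the proof of the Gehring–Hayman inequality. -/
def ghCost (n : ℕ) (M : ℝ) : ℝ := 3 * (1 + 4 * (2 * M * liftFactor M + liftShift M)) ^ n

theorem LengthCigar.length_le [FiniteDimensional ℝ E] (hΩ : ProperDomain Ω) {M : ℝ} (hM : 1 ≤ M)
    (hcig : LengthCigar Ω M) {g : ℝ → E} {l : ℝ} (hg : IsMinimal Ω g l) {α : Path (g 0) (g l)}
    (hα : InSet Ω α) (hr : Rectifiable α) :
    l ≤ (18 + 4 * M + 8 * Real.exp (ghCost (Module.finrank ℝ E) M)) * (len α).toReal := by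
  have : ProperSpace E := FiniteDimensional.proper ℝ E
  set K := ghCost (Module.finrank ℝ E) M with hK
  set L := (len α).toReal with hL
  have hL0 : 0 ≤ L := ENNReal.toReal_nonneg
  have hαd : ∀ u, dist (α u) (g 0) ≤ L := fun u => by
    have h1 := eVariationOn.edist_le α (mem_univ u) (mem_univ (0 : I))
    rw [α.source, edist_dist] at h1
    exact (ENNReal.ofReal_le_iff_le_toReal hr).1 h1
  have hgl : dist (g l) (g 0) ≤ L := by simpa using hαd 1
  rcases eq_or_lt_of_le hL0 with hL' | hLpos
  · rw [← hL'] at hgl ⊢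
    have h1 : g l = g 0 := dist_le_zero.1 hgl
    have h2 := hg.qcost_le
    rw [h1, hΩ.kd_self (hg.curve.mem 0)] at h2
    have h3 := hg.curve.length_le hΩ hg.nonneg
    have h4 : Real.exp (qcost Ω g 0 l) - 1 ≤ 0 := by
      have := Real.exp_le_one_iff.2 h2
      linarith
    nlinarith [hΩ.bdist_pos (hg.curve.mem 0)]
  by_contra! hcon
  have hexp := Real.exp_pos K
  have hML : 0 < M * L := by positivity
  have hl18 : 18 * L < l := by nlinarith [mul_pos hexp hLpos]
  have hl4M : 4 * (M * L) < l := by nlinarith [mul_pos hexp hLpos]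
  have hl8 : (2 + 8 * Real.exp K) * L < l := by nlinarith [mul_pos hexp hLpos]
  have hT := liftFactor_pos hM
  have hB := liftShift_pos hM
  set T := liftFactor M with hTdef
  have hx1 : L ≤ M * bdist Ω (g L) := by
    rcases hcig g l hg L ⟨hL0, by linarith⟩ with h | h <;> linarith
  have hy1 : L ≤ M * bdist Ω (g (l - L)) := by
    rcases hcig g l hg (l - L) ⟨by linarith, by linarith⟩ with h | h <;> linarith
  have hz : 2 * L < bdist Ω (g (l / 2)) := by
    have h1 : l / 2 ≤ M * bdist Ω (g (l / 2)) := by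
      rcases hcig g l hg (l / 2) ⟨by linarith, by linarith⟩ with h | h <;> linarith
    have h2 : M * (2 * L) < M * bdist Ω (g (l / 2)) := by linarith
    exact lt_of_mul_lt_mul_left h2 (by linarith)
  -- The common end points may lie close to the boundary. The end arcs connect α to points of height
  -- at least L/M without leaving the ball of radius 2L.
  set S : Set E := g '' Icc 0 L ∪ range α ∪ g '' Icc (l - L) l with hS
  have hgc := hg.curve.continuous
  have hSpre : IsPreconnected S := by
    refine IsPreconnected.union (g l) (.inr ⟨1, α.target⟩) ⟨l, ⟨by linarith, le_rfl⟩, rfl⟩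
      (IsPreconnected.union (g 0) ⟨0, ⟨le_rfl, hL0⟩, rfl⟩ ⟨0, α.source⟩
        (isPreconnected_Icc.image _ hgc.continuousOn) (isPreconnected_range α.continuous))
      (isPreconnected_Icc.image _ hgc.continuousOn)
  have hScomp : IsCompact S :=
    ((isCompact_Icc.image hgc).union (isCompact_range α.continuous)).union
      (isCompact_Icc.image hgc)
  have hxS : g L ∈ S := .inl (.inl ⟨L, ⟨hL0, le_rfl⟩, rfl⟩)
  have hyS : g (l - L) ∈ S := .inr ⟨l - L, ⟨le_rfl, by linarith⟩, rfl⟩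
  have hSΩ : S ⊆ Ω := by
    rintro _ ((⟨t, -, rfl⟩ | ⟨u, rfl⟩) | ⟨t, -, rfl⟩)
    exacts [hg.curve.mem t, hα u, hg.curve.mem t]
  have hSball : ∀ w ∈ S, dist w (g 0) ≤ 2 * L := by
    rintro _ ((⟨t, ht, rfl⟩ | ⟨u, rfl⟩) | ⟨t, ht, rfl⟩)
    · have := hg.curve.dist_le t 0
      rw [sub_zero, abs_of_nonneg ht.1] at this
      linarith [ht.2]
    · linarith [hαd u]
    · have := hg.curve.dist_le l t
      rw [abs_of_nonneg (by linarith [ht.2]), dist_comm] at this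
      linarith [dist_triangle (g t) (g l) (g 0), ht.1]
  obtain ⟨w₀, hw₀, hmin⟩ := hScomp.exists_isMinOn ⟨_, hxS⟩ (continuous_bdist Ω).continuousOn
  have hw₀pos := hΩ.bdist_pos (hSΩ hw₀)
  -- With Tq = L/M, the points g L and g (l - L) are their own lifts up to height q. Choosing k with
  -- q/2^k below the minimal height on S gives the initial chain, and k doublings bring it to height
  -- q.
  set q := L / (M * T) with hq
  have hq0 : 0 < q := by positivity
  have hTq : T * q = L / M := by rw [hq]; field_simp
  obtain ⟨k, hk⟩ := pow_unbounded_of_one_lt (q / bdist Ω w₀) one_lt_two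
  rw [div_lt_iff₀ hw₀pos] at hk
  have hks : (2 : ℝ) ^ k * (q / 2 ^ k) = q := by field_simp
  have hs0 : 0 < q / 2 ^ k := by positivity
  have hsub : S ⊆ region Ω (g 0) (q / 2 ^ k) (2 * L) := fun w hw => by
    refine ⟨hSΩ hw, le_trans ?_ (hmin hw), hSball w hw⟩
    rw [div_le_iff₀ (by positivity)]
    linarith
  have hxq : T * q ≤ bdist Ω (g L) := by
    rw [hTq, div_le_iff₀ (by linarith)]; linarith
  have hyq : T * q ≤ bdist Ω (g (l - L)) := by
    rw [hTq, div_le_iff₀ (by linarith)]; linarith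
  have hchain := hcig.chain_lift_iterate hΩ hM hs0 (hg.curve.mem (l / 2)) (hsub hxS) (hsub hyS)
    (chain_of_isPreconnected hs0 hSpre hsub hxS hyS) k
    (by
      rw [hks, hTq]
      refine lt_of_le_of_lt ?_ hz
      rw [mul_div_assoc', div_le_iff₀ (by linarith)]
      nlinarith)
    (by rw [hks]; exact hxq) (by rw [hks]; exact hyq)
  rw [hks] at hchain
  have hqT : q ≤ T * q := le_mul_of_one_le_left hq0.le (by rw [hTdef, liftFactor]; linarith)
  have hqs : q / 2 ^ k ≤ q := div_le_self hq0.le (one_le_pow₀ one_le_two)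
  have hρ0 : 0 ≤ liftShift M * (q - q / 2 ^ k) := mul_nonneg hB.le (by linarith)
  have hkd : kd Ω (g L) (g (l - L)) ≤ K := by
    refine (hchain.kd_le hΩ hq0
      ⟨hg.curve.mem L, hqT.trans hxq, by linarith [hSball _ hxS]⟩).trans ?_
    rw [hK, ghCost]
    gcongr
    rw [mul_div_assoc]
    gcongr
    rw [div_le_iff₀ hq0, ← hTdef]
    have h1 : 2 * M * T * q = 2 * L := by rw [mul_assoc, hTq]; field_simp
    have h2 : 0 < liftShift M * (q / 2 ^ k) := by positivity
    linarith
  have hLl : L ≤ l - L := by linarith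
  have hlen := hg.curve.length_le hΩ hLl
  rw [hg.qcost_eq hΩ hL0 hLl (by linarith)] at hlen
  set d := bdist Ω (g L) with hd
  have hd0 : 0 < d := hΩ.bdist_pos (hg.curve.mem L)
  -- If g L has height at most 8L, the bound K on the distance suffices. Otherwise the two points
  -- lie within 4L < d/2 of each other, and the middle arc has length at most 16L.
  rcases le_or_gt d (8 * L) with h8 | h8
  · have h1 := Real.exp_le_exp.2 hkd
    have h2 : d * (Real.exp (kd Ω (g L) (g (l - L))) - 1) ≤ 8 * L * Real.exp K := by
      refine mul_le_mul h8 (by linarith) ?_ (by positivity)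
      linarith [Real.add_one_le_exp (kd Ω (g L) (g (l - L))), hΩ.kd_nonneg (g L) (g (l - L))]
    linarith
  · have hdist : dist (g L) (g (l - L)) ≤ 4 * L := by
      have := dist_triangle_right (g L) (g (l - L)) (g 0)
      linarith [hSball _ hxS, hSball _ hyS]
    have h1 := hΩ.kd_le_of_dist_le (hg.curve.mem L) (hdist.trans (by rw [← hd]; linarith))
    have h2 := hΩ.kd_le_one (hg.curve.mem L) (hdist.trans (by rw [← hd]; linarith))
    have h3 := hΩ.kd_nonneg (g L) (g (l - L))
    have h4 := Real.abs_exp_sub_one_le (by rwa [abs_of_nonneg h3])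
    rw [abs_of_nonneg h3] at h4
    have h5 := (le_abs_self _).trans h4
    rw [← hd, le_div_iff₀ (by linarith)] at h1
    have h6 := mul_le_mul_of_nonneg_left h5 hd0.le
    nlinarith

theorem IsMinimal.ofReal_length_le [FiniteDimensional ℝ E] (hΩ : ProperDomain Ω) {M D : ℝ}
    (hM : 1 ≤ M) (hcig : LengthCigar Ω M)
    (hD : 18 + 4 * M + 8 * Real.exp (ghCost (Module.finrank ℝ E) M) ≤ D) {g : ℝ → E} {l : ℝ}
    (hg : IsMinimal Ω g l) : ENNReal.ofReal l ≤ ENNReal.ofReal D * innerDist Ω (g 0) (g l) := by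
  have hD0 : 0 < D := lt_of_lt_of_le (by positivity) hD
  rw [mul_comm, ← ENNReal.div_le_iff_le_mul (.inl (by simpa using hD0)) (.inl ENNReal.ofReal_ne_top)]
  refine le_iInf fun α => le_iInf fun hα => le_iInf fun hr => ?_
  rw [ENNReal.div_le_iff_le_mul (.inl (by simpa using hD0)) (.inl ENNReal.ofReal_ne_top),
    mul_comm, ← ENNReal.ofReal_toReal hr, ← ENNReal.ofReal_mul hD0.le]
  exact ENNReal.ofReal_le_ofReal ((hcig.length_le hΩ hM hg hα hr).trans
    (mul_le_mul_of_nonneg_right hD ENNReal.toReal_nonneg))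

theorem LengthCigar.innerUniform [FiniteDimensional ℝ E] (hΩ : ProperDomain Ω) {M D : ℝ}
    (hM : 1 ≤ M) (hcig : LengthCigar Ω M)
    (hD : 18 + 4 * M + 8 * Real.exp (ghCost (Module.finrank ℝ E) M) ≤ D) : InnerUniform Ω D := by
  have hexp := Real.exp_pos (ghCost (Module.finrank ℝ E) M)
  have : ProperSpace E := FiniteDimensional.proper ℝ E
  refine ⟨by linarith, fun x hx y hy => ?_⟩
  obtain ⟨g, l, hg, rfl, rfl⟩ := hΩ.exists_isMinimal hx hy
  refine ⟨hg.curve.toPath l, hg.curve.inSet_toPath, hg.curve.rectifiable_toPath hg.nonneg,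
    fun t => ?_, (hg.curve.len_toPath_le hg.nonneg).trans (hg.ofReal_length_le hΩ hM hcig hD)⟩
  rw [IsCurve.toPath_apply]
  have hb := hΩ.bdist_pos (hg.curve.mem (l * t))
  have hMD : M * bdist Ω (g (l * t)) ≤ D * bdist Ω (g (l * t)) :=
    mul_le_mul_of_nonneg_right (by linarith) hb.le
  rcases hcig g l hg (l * t) ⟨mul_nonneg hg.nonneg t.2.1, mul_le_of_le_one_right hg.nonneg t.2.2⟩
    with h | h
  · exact min_le_of_left_le ((hg.curve.lengthOn_Iic_toPath_le hg.nonneg t).trans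
      (ENNReal.ofReal_le_ofReal (h.trans hMD)))
  · exact min_le_of_right_le ((hg.curve.lengthOn_Ici_toPath_le hg.nonneg t).trans
      (ENNReal.ofReal_le_ofReal (h.trans hMD)))

theorem LengthCigar.gehringHayman [FiniteDimensional ℝ E] (hΩ : ProperDomain Ω) {M D : ℝ}
    (hM : 1 ≤ M) (hcig : LengthCigar Ω M)
    (hD : 18 + 4 * M + 8 * Real.exp (ghCost (Module.finrank ℝ E) M) ≤ D) : GehringHayman Ω D := by
  intro x y γ hγ
  obtain ⟨g, hg, h0, h1⟩ := hγ.exists_isMinimal hΩ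
  have := hg.ofReal_length_le hΩ hM hcig hD
  rwa [h0, h1, ENNReal.ofReal_toReal hγ.2.1] at this

/-! ### Numerical estimates for the constants -/

theorem cigarConst_le {n : ℕ} {A : ℝ} (hA : 1 / 2 ≤ A) :
    cigarConst n A ≤ (210 * A) ^ (2 * n + 1) := by
  have h1 : 4 * (A + 1) ≤ 210 * A := by linarith
  have h2 : 1 + 8 * A * (A + 1) ≤ (210 * A) ^ 2 := by nlinarith
  calc cigarConst n A ≤ 210 * A * ((210 * A) ^ 2) ^ n := by unfold cigarConst; gcongr
    _ = (210 * A) ^ (2 * n + 1) := by rw [← pow_mul, pow_succ]; ring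

theorem one_le_cigarConst {n : ℕ} {A : ℝ} (hA : 0 < A) : 1 ≤ cigarConst n A := by
  unfold cigarConst
  exact one_le_mul_of_one_le_of_one_le (by linarith) (one_le_pow₀ (by nlinarith))

theorem ghCost_le {n : ℕ} {M : ℝ} (hM : 1 ≤ M) :
    ghCost n M ≤ 3 * Real.exp (24 * n * M ^ 3) := by
  have hT : liftFactor M ≤ 4 * M := by unfold liftFactor; linarith
  have hT0 := liftFactor_pos hM
  have hcost : liftCost M ≤ 8 * M ^ 3 := by
    calc liftCost M ≤ M * (2 * M) * (4 * M) := by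
          unfold liftCost; gcongr; linarith
      _ = 8 * M ^ 3 := by ring
  have hMM : 0 < M ^ 2 := by positivity
  set e := Real.exp (16 * M ^ 3 + 1) with he
  have he1 : 1 ≤ e := Real.one_le_exp (by positivity)
  have hMT : M * liftFactor M ≤ 4 * M ^ 2 := by nlinarith
  have hB : liftShift M ≤ 4 * M ^ 2 + 12 * M ^ 2 * e := by
    have h1 : Real.exp (2 * liftCost M + 1) ≤ e := Real.exp_le_exp.2 (by linarith)
    have h2 : (M + 2) * liftFactor M ≤ 12 * M ^ 2 := by nlinarith
    unfold liftShift
    gcongr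
  have hM2 : M ^ 2 ≤ Real.exp (2 * M) := by
    have h1 : M ≤ Real.exp M := by linarith [Real.add_one_le_exp M]
    rw [two_mul, Real.exp_add]
    nlinarith
  have h97 : (97 : ℝ) ≤ Real.exp 5 := by
    have h1 := Real.exp_one_gt_d9
    have h2 : Real.exp 5 = Real.exp 1 ^ 5 := by rw [← Real.exp_nat_mul]; norm_num
    rw [h2]
    calc (97 : ℝ) ≤ 2.7 ^ 5 := by norm_num
      _ ≤ Real.exp 1 ^ 5 := by gcongr; linarith
  have hbase : 1 + 4 * (2 * M * liftFactor M + liftShift M) ≤ Real.exp (24 * M ^ 3) := by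
    have hM1 : 1 ≤ M ^ 2 := one_le_pow₀ hM
    have hMe : M ^ 2 ≤ M ^ 2 * e := le_mul_of_one_le_right hMM.le he1
    calc 1 + 4 * (2 * M * liftFactor M + liftShift M) ≤ 97 * M ^ 2 * e := by linarith
      _ ≤ Real.exp 5 * Real.exp (2 * M) * e := by gcongr
      _ = Real.exp (5 + 2 * M + (16 * M ^ 3 + 1)) := by rw [Real.exp_add, Real.exp_add]
      _ ≤ Real.exp (24 * M ^ 3) := by
        have h3 : M ^ 2 ≤ M ^ 3 := pow_le_pow_right₀ hM (by norm_num)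
        refine Real.exp_le_exp.2 ?_
        nlinarith
  have h0 : 0 ≤ 1 + 4 * (2 * M * liftFactor M + liftShift M) := by
    have := liftShift_pos hM
    positivity
  calc ghCost n M ≤ 3 * Real.exp (24 * M ^ 3) ^ n := by unfold ghCost; gcongr
    _ = 3 * Real.exp (24 * n * M ^ 3) := by rw [← Real.exp_nat_mul]; ring_nf

theorem four_mul_le_ghCost {n : ℕ} (hn : 1 ≤ n) {M : ℝ} (hM : 1 ≤ M) : 3 + 4 * M ≤ ghCost n M := by
  have hB := liftShift_pos hM
  have hT : 1 ≤ liftFactor M := by unfold liftFactor; linarith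
  have hMT : M ≤ M * liftFactor M := le_mul_of_one_le_right (by linarith) hT
  have := le_self_pow₀ (by nlinarith : 1 ≤ 1 + 4 * (2 * M * liftFactor M + liftShift M))
    (Nat.one_le_iff_ne_zero.1 hn)
  unfold ghCost
  linarith

theorem le_constC1 {n : ℕ} (hn : 1 ≤ n) {c₀ C : ℝ} (hA : 1 / 2 ≤ c₀ * C) :
    18 + 4 * cigarConst n (c₀ * C) + 8 * Real.exp (ghCost n (cigarConst n (c₀ * C))) ≤
      constC1 n c₀ C := by
  set M := cigarConst n (c₀ * C) with hMdef
  set X := 210 * (c₀ * C) with hX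
  have hX105 : 105 ≤ X := by linarith
  have hM : 1 ≤ M := one_le_cigarConst (by linarith)
  have hMX : M ≤ X ^ (2 * n + 1) := cigarConst_le hA
  set K := ghCost n M
  have hK1 : 3 + 4 * M ≤ K := four_mul_le_ghCost hn hM
  have hK2 : K ≤ 3 * Real.exp (24 * n * M ^ 3) := ghCost_le hM
  have hn' : (1 : ℝ) ≤ n := by exact_mod_cast hn
  have hM3 : 1 ≤ M ^ 3 := one_le_pow₀ hM
  have hnM : 1 ≤ n * M ^ 3 := one_le_mul_of_one_le_of_one_le hn' hM3
  have he := Real.exp_one_gt_d9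
  have hC2 : constC2 n c₀ C = X ^ (2 * n ^ 2 + 5 * n) := by
    rw [constC2, hX]; ring
  set Y := constC2 n c₀ C
  have hY : 105 ≤ Y := by
    rw [hC2]
    refine hX105.trans (le_self_pow₀ (by linarith) ?_)
    positivity
  -- Since M ≤ X^(2n+1), this reduces to 7n + 3 ≤ 4n² + 10n, true for n ≥ 1. Of the 26, 24 comes
  -- from `ghCost_le` and 2 absorbs the factor 6 ≤ e².
  have hY2 : 26 * n * M ^ 3 ≤ Y ^ 2 := by
    have h1 : (26 : ℝ) * n ≤ X ^ n := by
      have h2 := one_add_mul_le_pow (a := (104 : ℝ)) (by norm_num) n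
      have h3 : (1 + 104 : ℝ) ^ n ≤ X ^ n := by gcongr; linarith
      linarith
    calc 26 * n * M ^ 3 ≤ X ^ n * (X ^ (2 * n + 1)) ^ 3 := by gcongr
      _ = X ^ (n + (2 * n + 1) * 3) := by rw [← pow_mul, ← pow_add]
      _ ≤ X ^ ((2 * n ^ 2 + 5 * n) * 2) := pow_le_pow_right₀ (by linarith) (by nlinarith)
      _ = Y ^ 2 := by rw [hC2, ← pow_mul]
  have hYpow : Real.exp (Y ^ 2) ≤ Y ^ (3 + 4 * Y ^ 2) := by
    rw [Real.rpow_def_of_pos (by linarith)]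
    refine Real.exp_le_exp.2 ?_
    have hlog : 1 ≤ Real.log Y := by
      rw [Real.le_log_iff_exp_le (by linarith)]
      linarith [Real.exp_one_lt_d9]
    nlinarith [sq_nonneg Y]
  have h6 : (6 : ℝ) ≤ Real.exp 2 := by
    rw [show (2 : ℝ) = 1 + 1 by norm_num, Real.exp_add]
    nlinarith
  have h20 : (18 : ℝ) ≤ Real.exp 3 := by
    rw [show (3 : ℝ) = 2 + 1 by norm_num, Real.exp_add, show (2 : ℝ) = 1 + 1 by norm_num,
      Real.exp_add]
    have : 7.3 ≤ Real.exp 1 * Real.exp 1 := by nlinarith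
    nlinarith
  have h2K : 2 * K ≤ Y ^ (3 + 4 * Y ^ 2) := by
    calc 2 * K ≤ 6 * Real.exp (24 * n * M ^ 3) := by linarith
      _ ≤ Real.exp 2 * Real.exp (24 * n * M ^ 3) := by gcongr
      _ = Real.exp (2 + 24 * n * M ^ 3) := (Real.exp_add _ _).symm
      _ ≤ Real.exp (Y ^ 2) := Real.exp_le_exp.2 (by linarith)
      _ ≤ _ := hYpow
  have hKe : K ≤ Real.exp K := by linarith [Real.add_one_le_exp K]
  have hK3 : Real.exp 3 ≤ Real.exp K := Real.exp_le_exp.2 (by linarith)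
  calc 18 + 4 * M + 8 * Real.exp K ≤ 18 * Real.exp K := by linarith
    _ ≤ Real.exp K * Real.exp K := by gcongr; linarith
    _ = Real.exp (2 * K) := by rw [← Real.exp_add]; ring_nf
    _ ≤ constC1 n c₀ C := Real.exp_le_exp.2 h2K

end QHGeom

end
theorem theorem1p3 (n : ℕ) (Ω : Set (EuclideanSpace ℝ (Fin n)))
    (hΩ : QHGeom.IsDomainSet Ω) (hproper : Ω ≠ Set.univ)
    (c₀ C : ℝ) (hc₀ : 0 < c₀) (hC : 0 < C)
    (hLLC : QHGeom.LLC2 Ω c₀) (hsep : QHGeom.BallSeparation Ω C) :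
    QHGeom.InnerUniform Ω (QHGeom.constC1 n c₀ C) ∧
      QHGeom.GehringHayman Ω (QHGeom.constC1 n c₀ C) := by
  -- In dimension 0 a nonempty set is the whole space.
  have hn : 1 ≤ n := by
    rcases Nat.eq_zero_or_pos n with rfl | h
    · exact absurd (hΩ.2.nonempty.eq_univ) hproper
    · exact h
  have hD := hΩ.properDomain hproper
  have hdiam : ∀ g l, QHGeom.IsMinimal Ω g l → QHGeom.DiamCigar Ω (c₀ * C) g l :=
    fun g l hg => hg.diamCigar hD hc₀ hC hLLC hsep
  have hA : 0 < c₀ * C := mul_pos hc₀ hC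
  have hcig := QHGeom.lengthCigar_of_diamCigar hD hA hdiam
  have hle := QHGeom.le_constC1 hn (QHGeom.half_le_of_diamCigar hD hA hdiam)
  have hfin : Module.finrank ℝ (EuclideanSpace ℝ (Fin n)) = n := finrank_euclideanSpace_fin
  have hM := QHGeom.one_le_cigarConst (n := n) hA
  rw [hfin] at hcig
  exact ⟨hcig.innerUniform hD hM (by rwa [hfin]), hcig.gehringHayman hD hM (by rwa [hfin])⟩
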